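/- **Definitions.** A *Steinitz number* is a formal product $\xi=\prod_{p} p^{\chi_\xi(p)}$ over all primes $p$, with $\chi_\xi(p)\in\{0,1,\dots,\infty\}$; products add exponents and least common multiples take suprema of exponents. Two Steinitz numbers $\xi,\xi'$ are *asymptotically equivalent* if $m\,\xi=m'\,\xi'$ for some integers $m,m'\ge 1$; the equivalence class of $\xi$ is its *type* $\tau[\xi]$. A *group chain* in a group $\Gamma$ is a descending sequence $\mathcal G=\{\Gamma=\Gamma_0\supset\Gamma_1\supset\Gamma_2\supset\cdots\}$ of finite index subgroups (not assumed normal). For a finite index subgroup $H\subset\Gamma$ with $\Gamma_\ell\subset H$ for some $\ell\ge 1$, put $C^H_\ell=\bigcap_{\delta\in H}\delta\,\Gamma_\ell\,\delta^{-1}$ and, for $\gamma\in\Gamma$, $$\xi^H(\gamma)=\operatorname{lcm}\{\#(\langle\gamma\rangle/(\langle\gamma\rangle\cap C^H_\ell))\mid \ell>0\},\qquad \Xi_H[\mathcal G]=\{\tau[\xi^H(\gamma)]\mid\gamma\in\Gamma\}.$$ The *typeset* of $\mathcal G$ is $\Xi[\mathcal G]=\Xi_\Gamma[\mathcal G]$.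 The typesets of group chains $\mathcal G$ in $\Gamma$ and $\mathcal G'$ in $\Gamma'$ are *commensurable* if there are finite index subgroups $H\subset\Gamma$ with $\Gamma_\ell\subset H$ for some $\ell\ge1$ and $H'\subset\Gamma'$ with $\Gamma'_{\ell'}\subset H'$ for some $\ell'\ge1$ such that $\Xi_H[\mathcal G]=\Xi_{H'}[\mathcal G']$. A *presentation* $\mathcal P$ is a sequence of finite covering maps $q_\ell\colon M_\ell\to M_{\ell-1}$, $\ell\ge1$, each of degree at least $2$, where all $M_\ell$ are compact connected manifolds without boundary of the same dimension $n$. Its *solenoidal manifold* is $\mathcal M_{\mathcal P}=\varprojlim\{q_\ell\colon M_\ell\to M_{\ell-1}\}\subset\prod_{\ell\ge0}M_\ell$, with the topology induced from the product topology. A basepoint $x=(x_\ell)\in\mathcal M_{\mathcal P}$ determines the group chain $\mathcal G_{\mathcal P}=\{\Gamma_\ell\}$ in $\Gamma=\pi_1(M_0,x_0)$, where $\Gamma_\ell$ is the image of $\pi_1(M_\ell,x_\ell)$ under the composed covering map $q_1\circ\cdots\circ q_\ell\colon M_\ell\to M_0$; the action of $\Gamma$ on $\varprojlim\Gamma/\Gamma_\ell$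 is the monodromy odometer of $\mathcal P$, and the typeset of $\mathcal P$ is $\Xi[\mathcal P]=\Xi[\mathcal G_{\mathcal P}]$. **Theorem.** Let $\mathcal P$ and $\mathcal P'$ be presentations whose solenoidal manifolds $\mathcal M_{\mathcal P}$ and $\mathcal M_{\mathcal P'}$ are homeomorphic. Then, for every choice of basepoints $x\in\mathcal M_{\mathcal P}$ and $x'\in\mathcal M_{\mathcal P'}$, the typesets $\Xi[\mathcal P]$ and $\Xi[\mathcal P']$ of the associated group chains $\mathcal G_{\mathcal P}$ and $\mathcal G_{\mathcal P'}$ are commensurable. -/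

import Mathlib

universe u v

/-- A Steinitz (supernatural) number `∏ p ^ χ(p)`, given by its characteristic function
`χ` on the set of primes, with values in `{0, 1, …, ∞}`. -/
@[ext]
structure SteinitzNumber where
  χ : Nat.Primes → ℕ∞

namespace SteinitzNumber

/-- Multiplication of Steinitz numbers adds the exponents. -/
instance : Mul SteinitzNumber := ⟨fun ξ ξ' => ⟨fun p => ξ.χ p + ξ'.χ p⟩⟩

/-- A positive integer, seen as a Steinitz number through its prime factorization. -/
def ofNat (m : ℕ) : SteinitzNumber := ⟨fun p => (m.factorization p : ℕ∞)⟩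

/-- The least common multiple of a family of Steinitz numbers:
the exponent of each prime is the supremum of the exponents in the family. -/
noncomputable def lcm {ι : Type*} (ξ : ι → SteinitzNumber) : SteinitzNumber :=
  ⟨fun p => ⨆ i, (ξ i).χ p⟩

/-- Asymptotic equivalence: `m · ξ = m' · ξ'` for some positive integers `m`, `m'`. -/
def AsympEquiv (ξ ξ' : SteinitzNumber) : Prop :=
  ∃ m m' : ℕ, 1 ≤ m ∧ 1 ≤ m' ∧ ofNat m * ξ = ofNat m' * ξ'

theorem ofNat_mul (a b : ℕ) (ha : 1 ≤ a) (hb : 1 ≤ b) (ξ : SteinitzNumber) :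
    ofNat (a * b) * ξ = ofNat a * (ofNat b * ξ) := by
  ext p
  change (((a * b).factorization p : ℕ) : ℕ∞) + ξ.χ p
    = ((a.factorization p : ℕ) : ℕ∞) + (((b.factorization p : ℕ) : ℕ∞) + ξ.χ p)
  rw [Nat.factorization_mul (by omega) (by omega), Finsupp.add_apply, Nat.cast_add, add_assoc]

/-- Asymptotic equivalence as an equivalence relation. -/
def setoid : Setoid SteinitzNumber where
  r := AsympEquiv
  iseqv :=
    { refl := fun _ => ⟨1, 1, le_rfl, le_rfl, rfl⟩
      symm := fun ⟨m, m', h, h', e⟩ => ⟨m', m, h', h, e.symm⟩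
      trans := by
        rintro ξ₁ ξ₂ ξ₃ ⟨a, b, ha, hb, e⟩ ⟨c, d, hc, hd, e'⟩
        refine ⟨c * a, b * d, Nat.mul_pos hc ha, Nat.mul_pos hb hd, ?_⟩
        rw [ofNat_mul c a hc ha, e, ← ofNat_mul c b hc hb, Nat.mul_comm c b,
          ofNat_mul b c hb hc, e', ← ofNat_mul b d hb hd] }

end SteinitzNumber

/-- A type: an asymptotic equivalence class of Steinitz numbers. -/
def SteinitzType : Type := Quotient SteinitzNumber.setoid

/-- The type `τ[ξ]` of a Steinitz number `ξ`. -/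
def SteinitzNumber.type (ξ : SteinitzNumber) : SteinitzType :=
  Quotient.mk SteinitzNumber.setoid ξ

/-- A group chain `Γ = Γ₀ ⊇ Γ₁ ⊇ Γ₂ ⊇ ⋯` of finite index subgroups of `Γ`
(not assumed to be normal). -/
structure GroupChain (Γ : Type*) [Group Γ] where
  sub : ℕ → Subgroup Γ
  sub_zero : sub 0 = ⊤
  antitone : Antitone sub
  finiteIndex : ∀ ℓ, (sub ℓ).FiniteIndex

namespace GroupChain

variable {Γ : Type*} [Group Γ]

/-- `C_ℓ^H = ⋂_{δ ∈ H} δ Γ_ℓ δ⁻¹`; for `H = Γ` it is the normal core of `Γ_ℓ`. -/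
def restrictedCore (G : GroupChain Γ) (H : Subgroup Γ) (ℓ : ℕ) : Subgroup Γ :=
  ⨅ δ ∈ H, (G.sub ℓ).map (MulAut.conj δ).toMonoidHom

/-- The `H`-restricted order `ξ^H(γ) = lcm { #(⟨γ⟩ / (⟨γ⟩ ∩ C_ℓ^H)) | ℓ > 0 }` of `γ`. -/
noncomputable def restrictedOrder (G : GroupChain Γ) (H : Subgroup Γ) (γ : Γ) :
    SteinitzNumber :=
  SteinitzNumber.lcm fun ℓ : {ℓ : ℕ // 0 < ℓ} =>
    SteinitzNumber.ofNat
      (Nat.card (Subgroup.zpowers γ ⧸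
        (G.restrictedCore H ℓ.1).subgroupOf (Subgroup.zpowers γ)))

/-- The `H`-restricted typeset `Ξ_H[G] = { τ[ξ^H(γ)] | γ ∈ Γ }`. -/
def restrictedTypeset (G : GroupChain Γ) (H : Subgroup Γ) : Set SteinitzType :=
  {τ | ∃ γ : Γ, τ = (G.restrictedOrder H γ).type}

/-- The typeset `Ξ[G]`: the collection of the types of the Steinitz orders
`ξ(γ) = lcm { #(⟨γ⟩ / (⟨γ⟩ ∩ C_ℓ)) | ℓ > 0 }`, where `C_ℓ` is the normal core of `Γ_ℓ`. It is the
restricted typeset for `H = Γ`. -/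
def typeset (G : GroupChain Γ) : Set SteinitzType := G.restrictedTypeset ⊤

theorem restrictedCore_top (G : GroupChain Γ) (ℓ : ℕ) :
    G.restrictedCore ⊤ ℓ = (G.sub ℓ).normalCore := by
  ext g
  simp only [restrictedCore, Subgroup.mem_top, iInf_true, Subgroup.mem_iInf, Subgroup.mem_map,
    MulEquiv.coe_toMonoidHom, MulAut.conj_apply]
  constructor
  · intro h b
    obtain ⟨x, hx, e⟩ := h b⁻¹
    rw [← e]
    simpa [mul_assoc] using hx
  · intro h δ
    exact ⟨δ⁻¹ * g * δ, by simpa using h δ⁻¹, by group⟩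

/-- The typesets of the group chains `G` in `Γ` and `G'` in `Γ'` are commensurable: there are
finite index subgroups `H ⊆ Γ` and `H' ⊆ Γ'`, each containing some term of positive index
of the respective chain, with `Ξ_H[G] = Ξ_{H'}[G']`. -/
def TypesetsCommensurable {Γ' : Type*} [Group Γ'] (G : GroupChain Γ) (G' : GroupChain Γ') :
    Prop :=
  ∃ (H : Subgroup Γ) (H' : Subgroup Γ'),
    H.FiniteIndex ∧ (∃ ℓ, 1 ≤ ℓ ∧ G.sub ℓ ≤ H) ∧
    H'.FiniteIndex ∧ (∃ ℓ', 1 ≤ ℓ' ∧ G'.sub ℓ' ≤ H') ∧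
    G.restrictedTypeset H = G'.restrictedTypeset H'

end GroupChain

/-- A presentation: a sequence of proper (that is, of degree at least two) finite covering maps
`q_ℓ : M_{ℓ+1} → M_ℓ` between compact connected `n`-dimensional topological manifolds without
boundary. -/
structure SolenoidPresentation (n : ℕ) where
  M : ℕ → Type u
  [topologicalSpace : ∀ ℓ, TopologicalSpace (M ℓ)]
  [t2Space : ∀ ℓ, T2Space (M ℓ)]
  [compactSpace : ∀ ℓ, CompactSpace (M ℓ)]
  [connectedSpace : ∀ ℓ, ConnectedSpace (M ℓ)]
  [chartedSpace : ∀ ℓ, ChartedSpace (EuclideanSpace ℝ (Fin n)) (M ℓ)]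
  q : ∀ ℓ, M (ℓ + 1) → M ℓ
  isCoveringMap : ∀ ℓ, IsCoveringMap (q ℓ)
  finite_fiber : ∀ ℓ y, (q ℓ ⁻¹' {y}).Finite
  nontrivial_fiber : ∀ ℓ y, (q ℓ ⁻¹' {y}).Nontrivial

attribute [instance] SolenoidPresentation.topologicalSpace SolenoidPresentation.t2Space
  SolenoidPresentation.compactSpace SolenoidPresentation.connectedSpace
  SolenoidPresentation.chartedSpace

theorem IsCoveringMap.finiteIndex_range_mapOfEq {E X : Type*} [TopologicalSpace E]
    [TopologicalSpace X] {p : E → X} (cov : IsCoveringMap p) (e : E) {x : X} (h : p e = x)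
    (hfin : (p ⁻¹' {x}).Finite) :
    (FundamentalGroup.mapOfEq (⟨p, cov.continuous⟩ : C(E, X)) h).range.FiniteIndex := by
  classical
  let _ := cov.fundamentalGroupMulAction x
  have : Finite (p ⁻¹' {x}) := hfin
  let e' : p ⁻¹' {x} := ⟨e, h⟩
  have hs : (MulAction.stabilizer (FundamentalGroup X x) e').FiniteIndex := by
    refine ⟨?_⟩
    rw [MulAction.index_stabilizer]
    exact (Set.ncard_pos (Set.toFinite _)).2 ⟨e', MulAction.mem_orbit_self e'⟩ |>.ne'
  refine Subgroup.finiteIndex_of_le (H := MulAction.stabilizer (FundamentalGroup X x) e') ?_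
  intro γ hγ
  have hγ' : cov.monodromy γ e' = e' := hγ
  refine ⟨(cov.liftPathQuotient γ e').cast rfl (congrArg Subtype.val hγ').symm, ?_⟩
  rw [FundamentalGroup.mapOfEq_apply, Path.Homotopic.Quotient.map_cast]
  erw [cov.map_liftPathQuotient γ e']
  exact (Path.Homotopic.Quotient.cast_cast _ _ _ _ _).trans
    ((Path.Homotopic.Quotient.cast_cast _ _ _ _ _).trans
      (Path.Homotopic.Quotient.cast_rfl_rfl γ))

namespace SolenoidPresentation

variable {n : ℕ} (P : SolenoidPresentation.{u} n)

/-- The solenoidal manifold of `P`: the inverse limit of the maps `q_ℓ`, with the topology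
induced from the product topology. -/
abbrev Solenoid : Type u :=
  {x : ∀ ℓ, P.M ℓ // ∀ ℓ, P.q ℓ (x (ℓ + 1)) = x ℓ}

/-- The covering map `q_ℓ` as a bundled continuous map. -/
def qMap (ℓ : ℕ) : C(P.M (ℓ + 1), P.M ℓ) := ⟨P.q ℓ, (P.isCoveringMap ℓ).continuous⟩

theorem qMap_apply (x : P.Solenoid) (ℓ : ℕ) : P.qMap ℓ (x.1 (ℓ + 1)) = x.1 ℓ := x.2 ℓ

/-- The composed covering map `M_ℓ → M_0`. -/
def toBase : ∀ ℓ, C(P.M ℓ, P.M 0)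
  | 0 => ContinuousMap.id _
  | ℓ + 1 => (toBase ℓ).comp (P.qMap ℓ)

theorem toBase_apply (x : P.Solenoid) : ∀ ℓ, P.toBase ℓ (x.1 ℓ) = x.1 0
  | 0 => rfl
  | ℓ + 1 => by
    change P.toBase ℓ (P.q ℓ (x.1 (ℓ + 1))) = _
    rw [x.2 ℓ, toBase_apply x ℓ]

/-- The image of `π₁(M_ℓ, x_ℓ)` in `π₁(M_0, x_0)`. -/
noncomputable def chainSubgroup (x : P.Solenoid) (ℓ : ℕ) : Subgroup (FundamentalGroup (P.M 0) (x.1 0)) :=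
  (FundamentalGroup.mapOfEq (P.toBase ℓ) (P.toBase_apply x ℓ)).range

theorem chainSubgroup_zero (x : P.Solenoid) : P.chainSubgroup x 0 = ⊤ := by
  refine (Subgroup.eq_top_iff' _).2 fun γ => ⟨γ, ?_⟩
  rw [FundamentalGroup.mapOfEq_apply]
  induction γ using Path.Homotopic.Quotient.ind with
  | mk γ => rfl

theorem chainSubgroup_succ (x : P.Solenoid) (ℓ : ℕ) :
    P.chainSubgroup x (ℓ + 1) =
      (FundamentalGroup.mapOfEq (P.qMap ℓ) (P.qMap_apply x ℓ)).range.map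
        (FundamentalGroup.mapOfEq (P.toBase ℓ) (P.toBase_apply x ℓ)) := by
  rw [chainSubgroup, ← MonoidHom.range_comp]
  congr 1
  ext γ
  rw [MonoidHom.comp_apply, FundamentalGroup.mapOfEq_apply (P.toBase (ℓ + 1)),
    FundamentalGroup.mapOfEq_apply (P.toBase ℓ), FundamentalGroup.mapOfEq_apply (P.qMap ℓ)]
  induction γ using Path.Homotopic.Quotient.ind with
  | mk γ => rfl

theorem chainSubgroup_antitone (x : P.Solenoid) : Antitone (P.chainSubgroup x) :=
  antitone_nat_of_succ_le fun ℓ => by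
    rw [chainSubgroup_succ]
    exact Subgroup.map_le_range _ _

theorem chainSubgroup_finiteIndex (x : P.Solenoid) :
    ∀ ℓ, (P.chainSubgroup x ℓ).FiniteIndex
  | 0 => by rw [chainSubgroup_zero]; infer_instance
  | ℓ + 1 => by
    have ih := chainSubgroup_finiteIndex x ℓ
    have h1 := (P.isCoveringMap ℓ).finiteIndex_range_mapOfEq (x.1 (ℓ + 1)) (x.2 ℓ)
      (P.finite_fiber ℓ _)
    refine ⟨?_⟩
    rw [chainSubgroup_succ, Subgroup.index_map]
    refine mul_ne_zero ?_ ih.index_ne_zero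
    have : (FundamentalGroup.mapOfEq (P.qMap ℓ) (P.qMap_apply x ℓ)).range.FiniteIndex := h1
    exact (Subgroup.finiteIndex_of_le
      (H := (FundamentalGroup.mapOfEq (P.qMap ℓ) (P.qMap_apply x ℓ)).range) le_sup_left).index_ne_zero

/-- The group chain of the presentation `P` in the fundamental group `Γ = π₁(M_0, x_0)`, for the
basepoint `x = (x_ℓ)` of the solenoidal manifold: `Γ_ℓ` is the image of `π₁(M_ℓ, x_ℓ)` under the
covering map `M_ℓ → M_0`. The monodromy odometer is the action of `Γ` on the inverse limit of the
finite sets `Γ / Γ_ℓ`. -/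
noncomputable def groupChain (x : P.Solenoid) : GroupChain (FundamentalGroup (P.M 0) (x.1 0)) where
  sub := P.chainSubgroup x
  sub_zero := P.chainSubgroup_zero x
  antitone := P.chainSubgroup_antitone x
  finiteIndex := P.chainSubgroup_finiteIndex x

end SolenoidPresentation

/-! A homeomorphism of solenoids need not cover any map of the bases, but it carries paths to paths,
and a path in the base lifts uniquely through the whole tower once its starting thread is fixed. For
`γ` deep in the chain, the lift of `γ` at `x` ends at a point that agrees with `x` up to a high
level. Its image under the homeomorphism therefore ends near the image of `x`. Projecting this image
to the other base and closing it by a short path gives a loop, whose class does not depend on the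
short path because a compact manifold is uniformly locally simply connected
(`exists_smallHomotopic`).

The resulting function `f` (`exists_induced_map`) is multiplicative on a deep term, by a ladder of
short paths between close paths (`comp_cl_eq_of_close`). It is continuous for the topologies that
the chains define (`Induces.exists_mem`), and the function `g` induced by the inverse homeomorphism
inverts it on deep terms (`Induces.exists_leftInverse`). So `f` restricts to a homomorphism from
some `Γ_K` onto a finite index subgroup, under which the filtrations by restricted cores are cofinal
in each other. Steinitz orders of corresponding elements then agree (`restrictedOrder_eq`), and
types do not change under nonzero powers, so elements outside a finite index subgroup contribute
nothing new.

The given basepoint `x'` may lie outside the path component of the image of `x`. Moving the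
basepoint conjugates the terms beyond level `k` by elements that vary with the level but stay in the
`k`-th term. A restricted core over a subgroup containing that term absorbs them
(`TypesetsCommensurable.of_conj`). -/

section

open CategoryTheory Filter Set
open scoped Uniformity unitInterval SetRel

/-! ### Paths as groupoid morphisms, and small paths -/

namespace Path

variable {N : Type*} [TopologicalSpace N] {a b c d : N}

/-- The morphism of the fundamental groupoid represented by a path. -/
abbrev cl (p : Path a b) : FundamentalGroupoid.mk a ⟶ FundamentalGroupoid.mk b :=
  Path.Homotopic.Quotient.mk p

theorem cl_trans (p : Path a b) (q : Path b c) : (p.trans q).cl = p.cl ≫ q.cl := rfl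

theorem cl_eq_cl {p q : Path a b} : p.cl = q.cl ↔ p.Homotopic q :=
  Path.Homotopic.Quotient.eq

theorem cl_refl (a : N) : (Path.refl a).cl = 𝟙 _ := rfl

theorem cl_trans_symm (p : Path a b) : p.cl ≫ p.symm.cl = 𝟙 _ :=
  Path.Homotopic.Quotient.trans_symm _

theorem cl_symm_trans (p : Path a b) : p.symm.cl ≫ p.cl = 𝟙 _ :=
  Path.Homotopic.Quotient.symm_trans _

theorem cl_subpath_trans (p : Path a b) (r s t : I) :
    (p.subpath r s).cl ≫ (p.subpath s t).cl = (p.subpath r t).cl :=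
  cl_eq_cl.2 ⟨Path.Homotopy.subpathTransSubpath p r s t⟩

/-- Pointwise equal paths, possibly with endpoints that are only propositionally equal, represent
the same morphism up to constant paths. -/
theorem const_comp_cl_of_apply_eq {p : Path a b} {q : Path c d} (h : ∀ t, p t = q t)
    {s : Path a c} {s' : Path b d} (hs : ∀ t, s t = a) (hs' : ∀ t, s' t = b) :
    s.cl ≫ q.cl = p.cl ≫ s'.cl := by
  obtain rfl : a = c := by simpa using h 0
  obtain rfl : b = d := by simpa using h 1
  obtain rfl : p = q := Path.ext (funext h)
  obtain rfl : s = Path.refl a := Path.ext (funext hs)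
  obtain rfl : s' = Path.refl b := Path.ext (funext hs')
  rw [cl_refl, cl_refl, Category.id_comp, Category.comp_id]

/-- A path is `D`-small if any two of its points are `D`-close. -/
def Small (D : Set (N × N)) (p : Path a b) : Prop := ∀ s t, (p s, p t) ∈ D

theorem Small.mono {D E : Set (N × N)} {p : Path a b} (h : p.Small D) (hDE : D ⊆ E) :
    p.Small E := fun s t => hDE (h s t)

theorem Small.of_const {N : Type*} [UniformSpace N] {a b : N} {D : Set (N × N)} (hD : D ∈ 𝓤 N)
    {p : Path a b} (h : ∀ t, p t = a) : p.Small D :=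
  fun s t => by rw [h, h]; exact refl_mem_uniformity hD

theorem Small.trans {D E : SetRel N N} {p : Path a b} {q : Path b c}
    (hp : p.Small D) (hq : q.Small D) (hDE : D ○ D ⊆ E) : (p.trans q).Small E := by
  have key : ∀ u, (∃ s, (p.trans q) u = p s) ∨ ∃ s, (p.trans q) u = q s := by
    intro u
    have : (p.trans q) u ∈ Set.range (p.trans q) := ⟨u, rfl⟩
    rw [Path.trans_range] at this
    rcases this with ⟨s, hs⟩ | ⟨s, hs⟩
    exacts [.inl ⟨s, hs.symm⟩, .inr ⟨s, hs.symm⟩]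
  have hp1 : ∀ s, (p s, b) ∈ D ∧ (b, p s) ∈ D := fun s => by
    have h1 := hp s 1; have h2 := hp 1 s
    rw [p.target] at h1 h2; exact ⟨h1, h2⟩
  have hq0 : ∀ s, (q s, b) ∈ D ∧ (b, q s) ∈ D := fun s => by
    have h1 := hq s 0; have h2 := hq 0 s
    rw [q.source] at h1 h2; exact ⟨h1, h2⟩
  intro u v
  apply hDE
  refine ⟨b, ?_, ?_⟩
  · rcases key u with ⟨s, hs⟩ | ⟨s, hs⟩ <;> rw [hs]
    exacts [(hp1 s).1, (hq0 s).1]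
  · rcases key v with ⟨s, hs⟩ | ⟨s, hs⟩ <;> rw [hs]
    exacts [(hp1 s).2, (hq0 s).2]

/-- Any two `D`-small paths with the same endpoints are homotopic. -/
def SmallHomotopic (D : Set (N × N)) : Prop :=
  ∀ ⦃a b : N⦄ (p q : Path a b), p.Small D → q.Small D → p.cl = q.cl

theorem SmallHomotopic.mono {D E : Set (N × N)} (h : SmallHomotopic E) (hDE : D ⊆ E) :
    SmallHomotopic D := fun _ _ p q hp hq => h p q (hp.mono hDE) (hq.mono hDE)

end Path

/-! ### Uniform local connectivity of compact manifolds -/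

open Path

/-- Preimages of balls under charts are contractible, and a Lebesgue entourage for this cover puts
each small path inside one of them; two small paths with a common starting point land in the same
one. -/
theorem exists_smallHomotopic (n : ℕ) (N : Type*) [UniformSpace N] [CompactSpace N]
    [ChartedSpace (EuclideanSpace ℝ (Fin n)) N] : ∃ D ∈ 𝓤 N, SmallHomotopic D := by
  have key : ∀ z : N, ∃ U : Set N, IsOpen U ∧ z ∈ U ∧
      ∀ ⦃a b : N⦄ (p q : Path a b), (∀ t, p t ∈ U) → (∀ t, q t ∈ U) → p.cl = q.cl := by
    intro z
    set e := chartAt (EuclideanSpace ℝ (Fin n)) z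
    obtain ⟨r, hr, hball⟩ := Metric.isOpen_iff.1 e.open_target (e z)
      (mem_chart_target _ z)
    refine ⟨e.source ∩ e ⁻¹' Metric.ball (e z) r, e.isOpen_inter_preimage Metric.isOpen_ball,
      ⟨mem_chart_source _ z, Metric.mem_ball_self hr⟩, ?_⟩
    intro a b p q hp hq
    have := (convex_ball (e z) r).contractibleSpace ⟨_, Metric.mem_ball_self hr⟩
    let B := Metric.ball (e z) r
    let j : C(B, N) := ⟨fun y => e.symm y, by
      refine continuousOn_iff_continuous_domRestrict.1 (e.continuousOn_symm.mono hball)⟩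
    have ha : a ∈ e.source ∩ e ⁻¹' B := by simpa only [p.source] using hp 0
    have hb : b ∈ e.source ∩ e ⁻¹' B := by simpa only [p.target] using hp 1
    let push : ∀ p : Path a b, (∀ t, p t ∈ e.source ∩ e ⁻¹' B) →
        Path (⟨e a, ha.2⟩ : B) ⟨e b, hb.2⟩ := fun p hp =>
      { toFun := fun t => ⟨e (p t), (hp t).2⟩
        continuous_toFun := by
          refine Continuous.subtype_mk ?_ _
          exact e.continuousOn.comp_continuous p.continuous fun t => (hp t).1
        source' := by simp
        target' := by simp }
    have hja : a = j ⟨e a, ha.2⟩ := (e.left_inv ha.1).symm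
    have hjb : b = j ⟨e b, hb.2⟩ := (e.left_inv hb.1).symm
    have hpush : ∀ (p : Path a b) (hp : ∀ t, p t ∈ e.source ∩ e ⁻¹' B),
        ((push p hp).map j.continuous).cast hja hjb = p := by
      intro p hp
      ext t
      exact e.left_inv (hp t).1
    rw [cl_eq_cl, ← hpush p hp, ← hpush q hq]
    exact ((SimplyConnectedSpace.paths_homotopic (push p hp) (push q hq)).map j).pathCast _ _
  choose U hUo hUz hU using key
  obtain ⟨D, hD, h⟩ := lebesgue_number_lemma (isCompact_univ (X := N)) hUo
    (fun z _ => mem_iUnion.2 ⟨z, hUz z⟩)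
  refine ⟨D, hD, fun a b p q hp hq => ?_⟩
  obtain ⟨i, hi⟩ := h a (mem_univ _)
  refine hU i p q (fun t => hi ?_) (fun t => hi ?_)
  · have := hp 0 t; rwa [p.source] at this
  · have := hq 0 t; rwa [q.source] at this

/-- Lebesgue number argument again, now for a cover by path connected open sets of controlled size.
-/
theorem exists_small_path (N : Type*) [UniformSpace N] [CompactSpace N]
    [LocallyPathConnectedSpace N] {D : Set (N × N)} (hD : D ∈ 𝓤 N) :
    ∃ E ∈ 𝓤 N, ∀ a b : N, (a, b) ∈ E → ∃ p : Path a b, p.Small D := by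
  obtain ⟨D', hD', hsymm, hDD⟩ := comp_symm_mem_uniformity_sets hD
  have key : ∀ z : N, ∃ U : Set N, IsOpen U ∧ z ∈ U ∧ IsPathConnected U ∧
      U ⊆ UniformSpace.ball z D' := by
    intro z
    obtain ⟨o, ho, hoz, hoD⟩ := _root_.mem_nhds_iff.1 (UniformSpace.ball_mem_nhds z hD')
    refine ⟨pathComponentIn o z, hoz.pathComponentIn z, mem_pathComponentIn_self hoD,
      isPathConnected_pathComponentIn hoD, pathComponentIn_subset.trans ho⟩
  choose U hUo hUz hUp hU using key
  obtain ⟨E, hE, h⟩ := lebesgue_number_lemma (isCompact_univ (X := N)) hUo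
    (fun z _ => mem_iUnion.2 ⟨z, hUz z⟩)
  refine ⟨E, hE, fun a b hab => ?_⟩
  obtain ⟨i, hi⟩ := h a (mem_univ _)
  obtain ⟨p, hp⟩ := (hUp i).joinedIn a (hi (refl_mem_uniformity hE)) b (hi hab)
  refine ⟨p, fun s t => hDD ⟨i, ?_, hU i (hp t)⟩⟩
  exact SetRel.symm D' (hU i (hp s))

theorem exists_trans_small {N : Type*} [UniformSpace N] {D : Set (N × N)} (hD : D ∈ 𝓤 N) :
    ∃ E ∈ 𝓤 N, E ⊆ D ∧ ∀ {a b c d : N} (p : Path a b) (q : Path b c) (r : Path c d),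
      p.Small E → q.Small E → r.Small E → ((p.trans q).trans r).Small D := by
  obtain ⟨D', hD', h'⟩ := comp_mem_uniformity_sets hD
  obtain ⟨E, hE, h⟩ := comp_mem_uniformity_sets hD'
  have hED : E ⊆ D' := fun x hx => h ⟨x.1, refl_mem_uniformity hE, hx⟩
  have hDD : D' ⊆ D := fun x hx => h' ⟨x.1, refl_mem_uniformity hD', hx⟩
  exact ⟨E, hE, hED.trans hDD, fun p q r hp hq hr =>
    (hp.trans hq h).trans (hr.mono hED) h'⟩

theorem exists_subpath_small {N : Type*} [UniformSpace N] {D : Set (N × N)} (hD : D ∈ 𝓤 N)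
    {a b : N} (p : Path a b) (t : I) :
    ∃ O ∈ nhds t, ∀ r ∈ O, ∀ s ∈ O, (p.subpath r s).Small D := by
  have h1 : ∀ᶠ x : I × I in 𝓤 I, (p x.1, p x.2) ∈ D :=
    (CompactSpace.uniformContinuous_of_continuous p.continuous) hD
  obtain ⟨ε, hε, h⟩ := Metric.mem_uniformity_dist.1 h1
  refine ⟨Metric.ball t (ε / 2), Metric.ball_mem_nhds _ (by positivity), ?_⟩
  intro r hr s hs
  have hr' : ∀ u, ∃ y ∈ Metric.ball t (ε / 2), p.subpath r s u = p y := by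
    intro u
    have : p.subpath r s u ∈ p '' Set.uIcc r s := by rw [← Path.range_subpath]; exact ⟨u, rfl⟩
    obtain ⟨y, hy, e⟩ := this
    refine ⟨y, ?_, e.symm⟩
    rw [Metric.mem_ball, Subtype.dist_eq, Real.dist_eq, abs_lt] at hr hs ⊢
    have h1 : min (r : ℝ) s ≤ y := by
      have : min r s ≤ y := hy.1
      rcases min_le_iff.1 this with h | h
      exacts [min_le_iff.2 (.inl h), min_le_iff.2 (.inr h)]
    have h2 : (y : ℝ) ≤ max (r : ℝ) s := by
      have : y ≤ max r s := hy.2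
      rcases le_max_iff.1 this with h | h
      exacts [le_max_iff.2 (.inl h), le_max_iff.2 (.inr h)]
    rcases min_le_iff.1 h1 with h1 | h1 <;> rcases le_max_iff.1 h2 with h2 | h2 <;>
      constructor <;> linarith
  intro u v
  obtain ⟨y, hy, ey⟩ := hr' u
  obtain ⟨z, hz, ez⟩ := hr' v
  rw [ey, ez]
  refine h ?_
  calc dist y z ≤ dist y t + dist z t := dist_triangle_right _ _ _
    _ < ε / 2 + ε / 2 := add_lt_add hy hz
    _ = ε := by ring

/-- Two pointwise close paths are homotopic through any small paths that connect their
endpoints. -/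
theorem comp_cl_eq_of_close {N : Type*} [UniformSpace N] {D₀ D : Set (N × N)} {E : Set (N × N)}
    (hD₀ : SmallHomotopic D₀) (hD : D ∈ 𝓤 N)
    (htrans : ∀ {a b c d : N} (p : Path a b) (q : Path b c) (r : Path c d),
      p.Small D → q.Small D → r.Small D → ((p.trans q).trans r).Small D₀)
    (hDD₀ : D ⊆ D₀)
    (hE : ∀ a b : N, (a, b) ∈ E → ∃ p : Path a b, p.Small D)
    {a b c d : N} (p : Path a b) (q : Path c d) (hpq : ∀ t, (p t, q t) ∈ E)
    (s : Path a c) (s' : Path b d) (hs : s.Small D) (hs' : s'.Small D) :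
    s.cl ≫ q.cl = p.cl ≫ s'.cl := by
  have hu := hD₀.mono hDD₀
  -- Quantifying over all small rungs, not fixed ones, is what lets the statement pass between
  -- nearby times.
  let T : I → Prop := fun t => ∀ s : Path (p 0) (q 0), s.Small D →
    ∀ k : Path (p t) (q t), k.Small D → s.cl ≫ (q.subpath 0 t).cl = (p.subpath 0 t).cl ≫ k.cl
  have step : ∀ t : I, ∃ O ∈ nhds t, ∀ r ∈ O, ∀ r' ∈ O, T r → T r' := by
    intro t
    obtain ⟨O, hO, h⟩ := exists_subpath_small hD p t
    obtain ⟨O', hO', h'⟩ := exists_subpath_small hD q t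
    refine ⟨O ∩ O', inter_mem hO hO', fun r hr r' hr' hT s hs k hk => ?_⟩
    obtain ⟨m, hm⟩ := hE _ _ (hpq r)
    -- One small square of the ladder: back along `p`, across the rung `m`, forward along `q` is a
    -- small path with the endpoints of `k`, hence homotopic to `k`.
    have h1 := hT s hs m hm
    have h2 := hD₀ _ _ (htrans (p.subpath r' r) m (q.subpath r r') (h r' hr'.1 r hr.1) hm
      (h' r hr.2 r' hr'.2)) (hk.mono hDD₀)
    rw [cl_trans, cl_trans] at h2
    rw [← h2, ← cl_subpath_trans q 0 r r', ← Category.assoc, h1, ← Category.assoc,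
      ← Category.assoc, cl_subpath_trans p 0 r' r, Category.assoc]
  have hT0 : T 0 := by
    intro s hs k hk
    rw [Path.subpath_self, Path.subpath_self, cl_refl, cl_refl, Category.comp_id,
      Category.id_comp]
    exact hu _ _ hs hk
  have hT1 : T 1 := by
    -- Connectedness of the interval replaces a subdivision of it.
    refine PreconnectedSpace.induction₂' (fun r r' => T r → T r') (fun t => ?_)
      ⟨fun _ _ _ h h' => h' ∘ h⟩ 0 1 hT0
    obtain ⟨O, hO, h⟩ := step t
    filter_upwards [hO] with r hr
    exact ⟨h t (mem_of_mem_nhds hO) r hr, h r hr t (mem_of_mem_nhds hO)⟩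
  have := hT1 (s.cast p.source q.source) (fun u v => hs u v) (s'.cast p.target q.target)
    (fun u v => hs' u v)
  have hc : ∀ {a b c d : N} (p : Path a b) (q : Path c d) (s : Path a c) (s' : Path b d)
      (a' b' c' d' : N) (ha : a' = a) (hb : b' = b) (hc : c' = c) (hd : d' = d),
      (s.cast ha hc).cl ≫ (q.cast hc hd).cl = (p.cast ha hb).cl ≫ (s'.cast hb hd).cl →
      s.cl ≫ q.cl = p.cl ≫ s'.cl := by
    rintro a b c d p q s s' a' b' c' d' rfl rfl rfl rfl h
    exact h
  rw [Path.subpath_zero_one, Path.subpath_zero_one] at this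
  exact hc _ _ _ _ _ _ _ _ _ _ _ _ this

/-! ### Lifting maps, paths and homotopies to the solenoid -/

namespace SolenoidPresentation

open Path

variable {n : ℕ} (P : SolenoidPresentation.{u} n)

/-- The projection of the solenoidal manifold to `M_ℓ`. -/
def proj (ℓ : ℕ) : C(P.Solenoid, P.M ℓ) :=
  ⟨fun y => y.1 ℓ, (continuous_apply ℓ).comp continuous_subtype_val⟩

instance (ℓ : ℕ) : LocallyPathConnectedSpace (P.M ℓ) :=
  ChartedSpace.locallyPathConnectedSpace (EuclideanSpace ℝ (Fin n)) (P.M ℓ)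

instance : CompactSpace P.Solenoid := by
  have h : IsClosed {x : ∀ ℓ, P.M ℓ | ∀ ℓ, P.q ℓ (x (ℓ + 1)) = x ℓ} := by
    rw [Set.ofPred_forall]
    exact isClosed_iInter fun ℓ => isClosed_eq
      ((P.isCoveringMap ℓ).continuous.comp (continuous_apply _)) (continuous_apply _)
  exact isCompact_iff_compactSpace.1 h.isCompact

variable {P}

instance : LocallyPathConnectedSpace I := (convex_Icc (0 : ℝ) 1).locallyPathConnectedSpace

instance : SimplyConnectedSpace I :=
  have := (convex_Icc (0 : ℝ) 1).contractibleSpace ⟨0, by simp⟩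
  inferInstance

instance : SimplyConnectedSpace (I × I) :=
  have := (convex_Icc (0 : ℝ) 1).contractibleSpace ⟨0, by simp⟩
  inferInstance

section Lifting

variable {A : Type*} [TopologicalSpace A]

/-- Uniqueness of lifts through one covering at a time, by induction up the tower. -/
theorem eq_of_toBase_eq [PreconnectedSpace A] :
    ∀ (ℓ : ℕ) (F G : C(A, P.M ℓ)) (_ : ∀ a, P.toBase ℓ (F a) = P.toBase ℓ (G a))
      (a₀ : A) (_ : F a₀ = G a₀), F = G
  | 0, F, G, h, _, _ => ContinuousMap.ext h
  | ℓ + 1, F, G, h, a₀, h₀ => by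
    have := eq_of_toBase_eq ℓ ((P.qMap ℓ).comp F) ((P.qMap ℓ).comp G) h a₀
      (congrArg (P.qMap ℓ) h₀)
    refine DFunLike.coe_injective ((P.isCoveringMap ℓ).eq_of_comp_eq F.continuous G.continuous ?_
      a₀ h₀)
    exact congrArg DFunLike.coe this

/-- Agreement at level `k` forces agreement at level 0, and from there uniqueness of lifts gives
every level. -/
theorem solenoid_map_ext [PreconnectedSpace A] {k : ℕ} {F G : C(A, P.Solenoid)}
    (h : ∀ a, (F a).1 k = (G a).1 k) (a₀ : A) (h₀ : F a₀ = G a₀) : F = G := by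
  have key : ∀ ℓ, (P.proj ℓ).comp F = (P.proj ℓ).comp G := by
    intro ℓ
    refine eq_of_toBase_eq ℓ _ _ (fun a => ?_) a₀ (congrArg (P.proj ℓ) h₀)
    change P.toBase ℓ ((F a).1 ℓ) = P.toBase ℓ ((G a).1 ℓ)
    rw [P.toBase_apply, P.toBase_apply, ← P.toBase_apply _ k, ← P.toBase_apply (G a) k, h]
  ext a ℓ
  exact DFunLike.congr_fun (key ℓ) a

/-- Covering theory lifts one level at a time; the thread `y` prescribes the basepoint at each
level, so the lifts fit together into threads. -/
theorem exists_lift_proj_zero [SimplyConnectedSpace A] [LocallyPathConnectedSpace A]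
    (y : P.Solenoid) (f : C(A, P.M 0)) (a₀ : A) (h : f a₀ = y.1 0) :
    ∃ F : C(A, P.Solenoid), F a₀ = y ∧ ∀ a, (F a).1 0 = f a := by
  have step : ∀ ℓ (g : {g : C(A, P.M ℓ) // g a₀ = y.1 ℓ}),
      ∃ g' : {g : C(A, P.M (ℓ + 1)) // g a₀ = y.1 (ℓ + 1)}, ∀ a, P.q ℓ (g'.1 a) = g.1 a := by
    intro ℓ g
    obtain ⟨F, ⟨hF, hF'⟩, -⟩ := (P.isCoveringMap ℓ).existsUnique_continuousMap_lifts g.1 a₀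
      (y.1 (ℓ + 1)) ((y.2 ℓ).trans g.2.symm)
    exact ⟨⟨F, hF⟩, congrFun hF'⟩
  choose s hs using step
  let g : ∀ ℓ, {g : C(A, P.M ℓ) // g a₀ = y.1 ℓ} := fun ℓ => Nat.rec ⟨f, h⟩ s ℓ
  refine ⟨⟨fun a => ⟨fun ℓ => (g ℓ).1 a, fun ℓ => hs ℓ (g ℓ) a⟩,
    Continuous.subtype_mk (continuous_pi fun ℓ => (g ℓ).1.continuous) _⟩, ?_, fun _ => rfl⟩
  exact Subtype.ext (funext fun ℓ => (g ℓ).2)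

theorem exists_lift_proj [SimplyConnectedSpace A] [LocallyPathConnectedSpace A] {k : ℕ}
    (y : P.Solenoid) (f : C(A, P.M k)) (a₀ : A) (h : f a₀ = y.1 k) :
    ∃ F : C(A, P.Solenoid), F a₀ = y ∧ ∀ a, (F a).1 k = f a := by
  obtain ⟨F, hF, hF'⟩ := exists_lift_proj_zero y ((P.toBase k).comp f) a₀
    ((congrArg _ h).trans (P.toBase_apply y k))
  refine ⟨F, hF, fun a => ?_⟩
  refine DFunLike.congr_fun (eq_of_toBase_eq k ((P.proj k).comp F) f (fun a => ?_) a₀ ?_) a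
  · exact (P.toBase_apply (F a) k).trans (hF' a)
  · rw [h, ← hF]; rfl

theorem exists_lift_path {k : ℕ} (y : P.Solenoid) {c d : P.M k} (p : Path c d)
    (h : c = y.1 k) : ∃ (z : P.Solenoid) (r : Path y z), ∀ t, (r t).1 k = p t := by
  obtain ⟨F, hF, hF'⟩ := exists_lift_proj y p.toContinuousMap 0 (p.source.trans h)
  exact ⟨F 1, ⟨F, hF, rfl⟩, hF'⟩

end Lifting

/-- The projection to `M_ℓ` of a path in the solenoidal manifold. -/
def projPath (ℓ : ℕ) {y z : P.Solenoid} (p : Path y z) : Path (y.1 ℓ) (z.1 ℓ) :=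
  p.map (P.proj ℓ).continuous

@[simp]
theorem projPath_apply (ℓ : ℕ) {y z : P.Solenoid} (p : Path y z) (t : I) :
    projPath ℓ p t = (p t).1 ℓ := rfl

theorem projPath_trans (ℓ : ℕ) {y z w : P.Solenoid} (p : Path y z) (q : Path z w) :
    projPath ℓ (p.trans q) = (projPath ℓ p).trans (projPath ℓ q) :=
  Path.map_trans _ _ _

/-- `p` is a path in the solenoidal manifold, starting at the basepoint, that lifts the loop `γ`. -/
def IsLift {x w : P.Solenoid} (γ : FundamentalGroup (P.M 0) (x.1 0)) (p : Path x w) : Prop :=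
  ∃ s : Path (w.1 0) (x.1 0), (∀ t, s t = w.1 0) ∧ γ = (projPath 0 p).cl ≫ s.cl

theorem IsLift.apply_zero {x w : P.Solenoid} {γ : FundamentalGroup (P.M 0) (x.1 0)}
    {p : Path x w} (h : IsLift γ p) : w.1 0 = x.1 0 := by
  obtain ⟨s, hs, -⟩ := h
  simpa using (hs 1).symm

theorem homotopic_of_projPath_homotopic {x w v : P.Solenoid} (p : Path x w) (q : Path x v)
    (s : Path (w.1 0) (v.1 0)) (hs : ∀ t, s t = w.1 0)
    (h : (projPath 0 p).cl ≫ s.cl = (projPath 0 q).cl) :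
    ∃ e : w = v, p.Homotopic (q.cast rfl e) := by
  have hwv : w.1 0 = v.1 0 := by simpa using (hs 1).symm
  have h' : (projPath 0 p).cl = ((projPath 0 q).cast rfl hwv).cl := by
    have := const_comp_cl_of_apply_eq (p := (projPath 0 q).cast rfl hwv) (q := projPath 0 q)
      (fun _ => rfl) (s := Path.refl _) (s' := s) (fun _ => rfl) hs
    rw [cl_refl, Category.id_comp, ← h] at this
    have h2 := congrArg (· ≫ s.symm.cl) this
    simpa only [Category.assoc, cl_trans_symm, Category.comp_id] using h2
  obtain ⟨H⟩ := cl_eq_cl.1 h'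
  -- The whole square is lifted from one corner. Its four edges are then identified by uniqueness of
  -- lifts, each starting from a corner already known.
  obtain ⟨F, hF, hF'⟩ := exists_lift_proj_zero x H.toContinuousMap (0, 0) (by simp)
  have hbot : ∀ t, F (0, t) = p t := by
    have := solenoid_map_ext (k := 0) (F := F.comp ⟨fun t => (0, t), by fun_prop⟩)
      (G := p.toContinuousMap) (fun t => by
        change (F (0, t)).1 0 = (p t).1 0
        rw [hF']; exact H.apply_zero t) 0 (hF.trans p.source.symm)
    exact DFunLike.congr_fun this
  have hleft : ∀ t, F (t, 0) = x := by
    have := solenoid_map_ext (k := 0) (F := F.comp ⟨fun t => (t, 0), by fun_prop⟩)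
      (G := ContinuousMap.const I x) (fun t => by
        change (F (t, 0)).1 0 = x.1 0
        rw [hF']; exact H.source t) 0 hF
    exact DFunLike.congr_fun this
  have htop : ∀ t, F (1, t) = q t := by
    have := solenoid_map_ext (k := 0) (F := F.comp ⟨fun t => (1, t), by fun_prop⟩)
      (G := q.toContinuousMap) (fun t => by
        change (F (1, t)).1 0 = (q t).1 0
        rw [hF']; exact H.apply_one t) 0 ((hleft 1).trans q.source.symm)
    exact DFunLike.congr_fun this
  have hright : ∀ t, F (t, 1) = w := by
    have := solenoid_map_ext (k := 0) (F := F.comp ⟨fun t => (t, 1), by fun_prop⟩)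
      (G := ContinuousMap.const I w) (fun t => by
        change (F (t, 1)).1 0 = w.1 0
        rw [hF']; exact H.target t) 0 ((hbot 1).trans p.target)
    exact DFunLike.congr_fun this
  have e : w = v := by rw [← hright 1, htop 1, q.target]
  refine ⟨e, ⟨{ toContinuousMap := F, map_zero_left := hbot, map_one_left := htop, prop' := ?_ }⟩⟩
  rintro t a (rfl | rfl)
  · exact (hleft t).trans p.source.symm
  · exact (hright t).trans p.target.symm

theorem IsLift.unique {x w v : P.Solenoid} {γ : FundamentalGroup (P.M 0) (x.1 0)}
    {p : Path x w} {q : Path x v} (hp : IsLift γ p) (hq : IsLift γ q) :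
    ∃ e : w = v, p.Homotopic (q.cast rfl e) := by
  obtain ⟨s, hs, e⟩ := hp
  obtain ⟨s', hs', e'⟩ := hq
  have h1 : w.1 0 = x.1 0 := by simpa using (hs 1).symm
  refine homotopic_of_projPath_homotopic p q (s.trans s'.symm) (fun t => ?_) ?_
  · have : (s.trans s'.symm) t ∈ Set.range (s.trans s'.symm) := ⟨t, rfl⟩
    rw [Path.trans_range] at this
    have h2 : v.1 0 = x.1 0 := by simpa using (hs' 1).symm
    rcases this with ⟨u, hu⟩ | ⟨u, hu⟩
    · rw [← hu, hs]
    · rw [← hu]; exact (hs' _).trans (h2.trans h1.symm)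
  · rw [cl_trans, ← Category.assoc, ← e, e', Category.assoc, cl_trans_symm, Category.comp_id]

theorem exists_const_path {N : Type*} [TopologicalSpace N] {a b : N} (h : a = b) :
    ∃ s : Path a b, ∀ t, s t = a := by
  subst h; exact ⟨Path.refl a, fun _ => rfl⟩

theorem exists_isLift_of_mem {x : P.Solenoid} {k : ℕ} {γ : FundamentalGroup (P.M 0) (x.1 0)}
    (hγ : γ ∈ P.chainSubgroup x k) :
    ∃ (w : P.Solenoid) (p : Path x w), IsLift γ p ∧ w.1 k = x.1 k := by
  obtain ⟨δ, rfl⟩ := hγ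
  induction δ using Path.Homotopic.Quotient.ind with
  | mk δ =>
    obtain ⟨w, p, hp⟩ := exists_lift_path x δ rfl
    have hw : w.1 k = x.1 k := by simpa using hp 1
    have hw0 : w.1 0 = x.1 0 := by rw [← P.toBase_apply, hw, P.toBase_apply]
    obtain ⟨s, hs⟩ := exists_const_path hw0
    refine ⟨w, p, ⟨s, hs, ?_⟩, hw⟩
    rw [FundamentalGroup.mapOfEq_apply]
    have := const_comp_cl_of_apply_eq (p := projPath 0 p) (s := Path.refl _) (s' := s)
      (q := ((δ.map (P.toBase k).continuous).cast (P.toBase_apply x k).symm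
        (P.toBase_apply x k).symm)) (fun t => by
          rw [projPath_apply, Path.cast_coe, Path.map_coe, Function.comp_apply, ← hp,
            P.toBase_apply]) (fun _ => rfl) hs
    rw [cl_refl, Category.id_comp] at this
    exact this

/-- Membership supplies one lift that closes up at level `k`; uniqueness of lifts transfers this to
`p`. -/
theorem IsLift.apply_eq_of_mem {x w : P.Solenoid} {k : ℕ} {γ : FundamentalGroup (P.M 0) (x.1 0)}
    {p : Path x w} (h : IsLift γ p) (hγ : γ ∈ P.chainSubgroup x k) : w.1 k = x.1 k := by
  obtain ⟨w', p', h', e⟩ := exists_isLift_of_mem hγ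
  obtain ⟨rfl, -⟩ := h.unique h'
  exact e

theorem exists_isLift {x : P.Solenoid} (γ : FundamentalGroup (P.M 0) (x.1 0)) :
    ∃ (w : P.Solenoid) (p : Path x w), IsLift γ p := by
  obtain ⟨w, p, h, -⟩ := exists_isLift_of_mem (k := 0) (γ := γ)
    (by rw [P.chainSubgroup_zero]; trivial)
  exact ⟨w, p, h⟩

/-- A path of the solenoidal manifold that starts at the basepoint, closed up in `M_k`, represents
an element of `Γ_k`. -/
theorem mem_chainSubgroup {x w : P.Solenoid} {k : ℕ} (p : Path x w)
    (s : Path (w.1 k) (x.1 k)) (s₀ : Path (w.1 0) (x.1 0))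
    (hs : ∀ t, s₀ t = P.toBase k (s t)) :
    ((projPath 0 p).cl ≫ s₀.cl : FundamentalGroup (P.M 0) (x.1 0)) ∈ P.chainSubgroup x k := by
  refine ⟨((projPath k p).trans s).cl, ?_⟩
  rw [FundamentalGroup.mapOfEq_apply]
  have : ((projPath 0 p).trans s₀) = (((projPath k p).trans s).map (P.toBase k).continuous).cast
      (P.toBase_apply x k).symm (P.toBase_apply x k).symm := by
    ext t
    simp only [Path.cast_coe, Path.map_coe, Function.comp_apply, Path.trans_apply]
    split_ifs
    · exact (P.toBase_apply _ _).symm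
    · exact hs _
  rw [← cl_trans, this]
  rfl

end SolenoidPresentation

/-! ### The uniform structure seen level by level -/

namespace SolenoidPresentation

open Path

variable {n : ℕ} {P : SolenoidPresentation.{u} n}

/-- The unique uniform structure of the compact Hausdorff space `M_ℓ`. -/
noncomputable abbrev uniformSpaceLevel (P : SolenoidPresentation.{u} n) (ℓ : ℕ) :
    UniformSpace (P.M ℓ) := uniformSpaceOfCompactR1

attribute [local instance] uniformSpaceLevel

/-- Makes the product uniformity a directed infimum, so that each entourage comes from a single
level. -/
theorem uniformity_proj_antitone : Antitone fun k : ℕ =>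
    comap (fun q : P.Solenoid × P.Solenoid => (q.1.1 k, q.2.1 k)) (𝓤 (P.M k)) := by
  refine antitone_nat_of_succ_le fun k => ?_
  have h : UniformContinuous (P.q k) :=
    CompactSpace.uniformContinuous_of_continuous (P.isCoveringMap k).continuous
  intro s hs
  obtain ⟨V, hV, hVs⟩ := mem_comap.1 hs
  refine mem_comap.2 ⟨_, h hV, fun q hq => hVs ?_⟩
  have : (P.q k (q.1.1 (k + 1)), P.q k (q.2.1 (k + 1))) ∈ V := hq
  rwa [q.1.2, q.2.2] at this

/-- A continuous map on the solenoidal manifold is uniformly controlled by the projection to any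
sufficiently high level. -/
theorem exists_level_control {N : Type*} [UniformSpace N] (g : C(P.Solenoid, N))
    {U : Set (N × N)} (hU : U ∈ 𝓤 N) :
    ∃ b₀, ∀ b ≥ b₀, ∃ V ∈ 𝓤 (P.M b), ∀ y z : P.Solenoid, (y.1 b, z.1 b) ∈ V → (g y, g z) ∈ U := by
  have h : {q : P.Solenoid × P.Solenoid | (g q.1, g q.2) ∈ U} ∈ 𝓤 P.Solenoid :=
    CompactSpace.uniformContinuous_of_continuous g.continuous hU
  rw [uniformity_subtype, Pi.uniformity, comap_iInf] at h
  simp only [comap_comap] at h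
  obtain ⟨b₀, hb₀⟩ := (mem_iInf_of_directed
    (directed_of_isDirected_le (uniformity_proj_antitone (P := P))) _).1 h
  refine ⟨b₀, fun b hb => ?_⟩
  obtain ⟨V, hV, hVs⟩ := mem_comap.1 (uniformity_proj_antitone (P := P) hb hb₀)
  exact ⟨V, hV, fun y z hyz => hVs (a := (y, z)) hyz⟩

end SolenoidPresentation

/-! ### The map of fundamental groups induced by a map of solenoids -/

namespace SolenoidPresentation

open Path

attribute [local instance] uniformSpaceLevel

variable {n n' : ℕ} {P : SolenoidPresentation.{u} n} {P' : SolenoidPresentation.{v} n'}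

/-- The image of a path under a map, with a prescribed starting point. -/
theorem exists_image_path (ψ : C(P.Solenoid, P'.Solenoid)) {x w : P.Solenoid}
    {x' : P'.Solenoid} (hx : ψ x = x') (p : Path x w) :
    ∃ (w' : P'.Solenoid) (p' : Path x' w'), ∀ t, p' t = ψ (p t) := by
  subst hx
  exact ⟨ψ w, p.map ψ.continuous, fun _ => rfl⟩

theorem image_path_unique (ψ : C(P.Solenoid, P'.Solenoid)) {x w v : P.Solenoid}
    {x' w' v' : P'.Solenoid} {p : Path x w} {q : Path x v} (e : w = v)
    (h : p.Homotopic (q.cast rfl e)) {p' : Path x' w'} {q' : Path x' v'}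
    (hp : ∀ t, p' t = ψ (p t)) (hq : ∀ t, q' t = ψ (q t)) :
    ∃ e' : w' = v', p'.Homotopic (q'.cast rfl e') := by
  subst e
  obtain rfl : ψ x = x' := by simpa using (hp 0).symm
  obtain rfl : ψ w = w' := by simpa using (hp 1).symm
  obtain rfl : ψ w = v' := by simpa using (hq 1).symm
  refine ⟨rfl, ?_⟩
  obtain rfl : p' = p.map ψ.continuous := Path.ext (funext hp)
  obtain rfl : q' = q.map ψ.continuous := Path.ext (funext hq)
  exact h.map ψ

/-- The defining property of the map between the fundamental groups of the bases that is induced by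
a map `ψ` of solenoidal manifolds: deep in the group chain, it is computed by lifting loops,
applying `ψ` and closing up by paths that are small at a given level. -/
def Induces (ψ : C(P.Solenoid, P'.Solenoid)) {x : P.Solenoid} {x' : P'.Solenoid}
    (f : FundamentalGroup (P.M 0) (x.1 0) → FundamentalGroup (P'.M 0) (x'.1 0)) : Prop :=
  ∀ b, ∀ V ∈ 𝓤 (P'.M b), ∃ k, ∀ γ ∈ P.chainSubgroup x k,
    ∀ (w : P.Solenoid) (p : Path x w), IsLift γ p →
    ∀ (w' : P'.Solenoid) (p' : Path x' w'), (∀ t, p' t = ψ (p t)) →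
    ∃ (s : Path (w'.1 b) (x'.1 b)) (s₀ : Path (w'.1 0) (x'.1 0)), s.Small V ∧
      (∀ t, s₀ t = P'.toBase b (s t)) ∧ f γ = (projPath 0 p').cl ≫ s₀.cl

/-- A continuous map `ψ` between solenoidal manifolds induces a function between the fundamental
groups of the bases, by lifting loops, applying `ψ`, projecting, and closing up by a short path.
It is multiplicative on a deep term of the group chain. -/
theorem exists_induced_map (ψ : C(P.Solenoid, P'.Solenoid)) (x : P.Solenoid) (x' : P'.Solenoid)
    (hx : ψ x = x') :
    ∃ (a : ℕ) (f : FundamentalGroup (P.M 0) (x.1 0) → FundamentalGroup (P'.M 0) (x'.1 0)),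
      (∀ γ₁ ∈ P.chainSubgroup x a, ∀ γ₂ ∈ P.chainSubgroup x a, f (γ₁ * γ₂) = f γ₁ * f γ₂) ∧
      Induces ψ f := by
  classical
  obtain ⟨D₀, hD₀, hnull⟩ := exists_smallHomotopic n' (P'.M 0)
  obtain ⟨D, hD, hDD₀, htrans⟩ := exists_trans_small hD₀
  obtain ⟨E, hE, hclose⟩ := exists_small_path (P'.M 0) hD
  obtain ⟨a, ha⟩ := exists_level_control ((P'.proj 0).comp ψ) hE
  obtain ⟨W, hW, ha⟩ := ha a le_rfl
  -- Points with equal `a`-th coordinate have images that a `D`-small path can join in the target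
  -- base.
  replace ha : ∀ y z : P.Solenoid, y.1 a = z.1 a → ((ψ y).1 0, (ψ z).1 0) ∈ E := fun y z h =>
    ha y z (by rw [h]; exact refl_mem_uniformity hW)
  have hnull' := hnull.mono hDD₀
  have hf : ∀ γ : FundamentalGroup (P.M 0) (x.1 0), ∃ γ' : FundamentalGroup (P'.M 0) (x'.1 0),
      ∀ (w : P.Solenoid) (p : Path x w), IsLift γ p →
      ∀ (w' : P'.Solenoid) (p' : Path x' w'), (∀ t, p' t = ψ (p t)) →
      ∀ s : Path (w'.1 0) (x'.1 0), s.Small D → γ' = (projPath 0 p').cl ≫ s.cl := by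
    intro γ
    by_cases hex : ∃ (w : P.Solenoid) (p : Path x w) (_ : IsLift γ p) (w' : P'.Solenoid)
        (p' : Path x' w') (_ : ∀ t, p' t = ψ (p t)) (s : Path (w'.1 0) (x'.1 0)), s.Small D
    · obtain ⟨w, p, hp, w', p', hp', s, hs⟩ := hex
      refine ⟨(projPath 0 p').cl ≫ s.cl, fun v q hq v' q' hq' r hr => ?_⟩
      obtain ⟨e, h⟩ := hp.unique hq
      obtain ⟨rfl, h'⟩ := image_path_unique ψ e h hp' hq'
      rw [hnull' s r hs hr]
      exact congrArg (· ≫ r.cl) (cl_eq_cl.2 (h'.map (P'.proj 0)))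
    -- A junk value: if no lift of `γ` has an image that closes up by a small path, the condition is
    -- vacuous.
    · refine ⟨1, fun w p hp w' p' hp' s hs => ?_⟩
      exact absurd ⟨w, p, hp, w', p', hp', s, hs⟩ hex
  choose f hf using hf
  refine ⟨a, f, ?_, ?_⟩
  · intro γ₁ h₁ γ₂ h₂
    obtain ⟨w₁, p₁, l₁⟩ := exists_isLift γ₁
    obtain ⟨w₂, p₂, l₂⟩ := exists_isLift γ₂
    have e₁ := l₁.apply_eq_of_mem h₁
    have e₂ := l₂.apply_eq_of_mem h₂
    -- The product composes `γ₂` first, so its lift continues `p₂` by a copy `r` of `p₁` starting at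
    -- `w₂`. Since `r` and `p₁` agree at level `a`, their images project to close paths in the
    -- target base.
    obtain ⟨w₃, r, hr⟩ := exists_lift_path w₂ (projPath a p₁) e₂.symm
    replace hr : ∀ t, (r t).1 a = (p₁ t).1 a := hr
    have hr0 : ∀ t, (r t).1 0 = (p₁ t).1 0 := fun t => by
      rw [← P.toBase_apply _ a, hr, P.toBase_apply]
    have e₃ : w₃.1 a = w₁.1 a := by simpa using hr 1
    have l₃ : IsLift (γ₁ * γ₂) (p₂.trans r) := by
      obtain ⟨s₁, hs₁, g₁⟩ := id l₁
      obtain ⟨s₂, hs₂, g₂⟩ := id l₂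
      have e0 : w₃.1 0 = w₁.1 0 := by rw [← P.toBase_apply _ a, e₃, P.toBase_apply]
      obtain ⟨c, hc⟩ := exists_const_path e0
      obtain ⟨s₃, hs₃⟩ := exists_const_path (e0.trans l₁.apply_zero)
      refine ⟨s₃, hs₃, ?_⟩
      have h1 := const_comp_cl_of_apply_eq (p := projPath 0 r) (q := projPath 0 p₁) hr0
        hs₂ hc
      have h2 : c.cl ≫ s₁.cl = s₃.cl := by
        refine congrArg cl (a₁ := c.trans s₁) (a₂ := s₃) ?_
        ext t
        rw [hs₃, Path.trans_apply]
        split_ifs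
        · rw [hc]
        · rw [hs₁, e0]
      change γ₂ ≫ γ₁ = _
      rw [g₁, g₂, projPath_trans, cl_trans, Category.assoc, Category.assoc, ← h2,
        ← Category.assoc s₂.cl, h1, Category.assoc]
    subst hx
    obtain ⟨s₁, hs₁⟩ := hclose _ _ (ha w₁ x e₁)
    obtain ⟨s₂, hs₂⟩ := hclose _ _ (ha w₂ x e₂)
    obtain ⟨s₃, hs₃⟩ := hclose _ _ (ha w₃ x (e₃.trans e₁))
    obtain ⟨s', hs'⟩ := hclose _ _ (ha w₃ w₁ e₃)
    rw [hf _ _ _ l₁ _ (p₁.map ψ.continuous) (fun _ => rfl) s₁ hs₁,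
      hf _ _ _ l₂ _ (p₂.map ψ.continuous) (fun _ => rfl) s₂ hs₂,
      hf _ _ _ l₃ _ ((p₂.trans r).map ψ.continuous) (fun _ => rfl) s₃ hs₃]
    have hladder := comp_cl_eq_of_close hnull hD htrans hDD₀ hclose
      (projPath 0 (r.map ψ.continuous)) (projPath 0 (p₁.map ψ.continuous))
      (fun t => ha _ _ (hr t)) s₂ s' hs₂ hs'
    have hs₃' : s₃.cl = s'.cl ≫ s₁.cl := by
      have h := hnull ((s'.trans s₁).trans (Path.refl _)) s₃
        (htrans _ _ _ hs' hs₁ (Small.of_const hD fun _ => rfl)) (hs₃.mono hDD₀)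
      rw [cl_trans, cl_trans, cl_refl, Category.comp_id] at h
      exact h.symm
    rw [Path.map_trans, projPath_trans, cl_trans, hs₃']
    change _ = ((projPath 0 (p₂.map ψ.continuous)).cl ≫ s₂.cl) ≫
      ((projPath 0 (p₁.map ψ.continuous)).cl ≫ s₁.cl)
    rw [Category.assoc, Category.assoc, ← Category.assoc s₂.cl, hladder, Category.assoc]
  · intro b V hV
    have hu : UniformContinuous (P'.toBase b) :=
      CompactSpace.uniformContinuous_of_continuous (P'.toBase b).continuous
    -- The closing path is chosen at level `b`, small enough that its projection to the base is
    -- `D`-small and hence computes `f`.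
    obtain ⟨E', hE', hclose'⟩ := exists_small_path (P'.M b) (inter_mem hV (hu hD))
    obtain ⟨k, hk⟩ := exists_level_control ((P'.proj b).comp ψ) hE'
    obtain ⟨W', hW', hk⟩ := hk k le_rfl
    refine ⟨k, fun γ hγ w p hp w' p' hp' => ?_⟩
    obtain rfl : ψ w = w' := by simpa using (hp' 1).symm
    subst hx
    obtain ⟨s, hs⟩ := hclose' _ _ (hk w x
      (by rw [hp.apply_eq_of_mem hγ]; exact refl_mem_uniformity hW'))
    let s₀ : Path ((ψ w).1 0) ((ψ x).1 0) :=
      (s.map (P'.toBase b).continuous).cast (P'.toBase_apply _ b).symm (P'.toBase_apply _ b).symm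
    refine ⟨s, s₀, hs.mono inter_subset_left, fun t => rfl, ?_⟩
    exact hf _ _ _ hp _ _ hp' _ fun t t' => (hs t t').2

end SolenoidPresentation

/-! ### Continuity and inversion of induced maps -/

namespace SolenoidPresentation

open Path

attribute [local instance] uniformSpaceLevel

variable {n n' : ℕ} {P : SolenoidPresentation.{u} n} {P' : SolenoidPresentation.{v} n'}

/-- Only closing up at level `m` matters here, so the entourage can be everything. -/
theorem Induces.exists_mem {ψ : C(P.Solenoid, P'.Solenoid)} {x : P.Solenoid} {x' : P'.Solenoid}
    {f : FundamentalGroup (P.M 0) (x.1 0) → FundamentalGroup (P'.M 0) (x'.1 0)}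
    (hf : Induces ψ f) (hx : ψ x = x') (m : ℕ) :
    ∃ k, ∀ γ ∈ P.chainSubgroup x k, f γ ∈ P'.chainSubgroup x' m := by
  obtain ⟨k, hk⟩ := hf m univ univ_mem
  refine ⟨k, fun γ hγ => ?_⟩
  obtain ⟨w, p, hp⟩ := exists_isLift γ
  obtain ⟨w', p', hp'⟩ := exists_image_path ψ hx p
  obtain ⟨s, s₀, -, hs₀, e⟩ := hk γ hγ w p hp w' p' hp'
  rw [e]
  exact mem_chainSubgroup p' s s₀ hs₀

/-- A lift of `f γ` is the image of a lift of `γ` followed by a lift of the short closing path.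
Applying `φ` returns the lift of `γ` followed by a path with small projection to the base, which
does not change the class. -/
theorem Induces.exists_leftInverse {ψ : C(P.Solenoid, P'.Solenoid)}
    {φ : C(P'.Solenoid, P.Solenoid)} (hφψ : ∀ y, φ (ψ y) = y) {x : P.Solenoid}
    {x' : P'.Solenoid} (hx : ψ x = x')
    {f : FundamentalGroup (P.M 0) (x.1 0) → FundamentalGroup (P'.M 0) (x'.1 0)}
    {g : FundamentalGroup (P'.M 0) (x'.1 0) → FundamentalGroup (P.M 0) (x.1 0)}
    (hf : Induces ψ f) (hg : Induces φ g) :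
    ∃ k, ∀ γ ∈ P.chainSubgroup x k, g (f γ) = γ := by
  obtain ⟨D₀, hD₀, hnull⟩ := exists_smallHomotopic n (P.M 0)
  obtain ⟨D, hD, hDD₀, htrans⟩ := exists_trans_small hD₀
  obtain ⟨b, hb⟩ := exists_level_control ((P.proj 0).comp φ) hD
  obtain ⟨k', hk'⟩ := hg 0 D hD
  -- Level `b` makes `φ` of the short path small; level `k'` places `f γ` where `g` is computed by
  -- lifting.
  obtain ⟨V, hV, hVD⟩ := hb (max b k') (le_max_left _ _)
  obtain ⟨k, hk⟩ := hf (max b k') V hV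
  refine ⟨k, fun γ hγ => ?_⟩
  obtain ⟨w, p, hp⟩ := exists_isLift γ
  obtain ⟨w', p', hp'⟩ := exists_image_path ψ hx p
  obtain ⟨s, s₀, hs, hs₀, e⟩ := hk γ hγ w p hp w' p' hp'
  have hmem : f γ ∈ P'.chainSubgroup x' k' := by
    rw [e]
    exact P'.chainSubgroup_antitone x' (le_max_right _ _) (mem_chainSubgroup p' s s₀ hs₀)
  obtain ⟨z, r, hr⟩ := exists_lift_path w' s rfl
  have hz : z.1 (max b k') = x'.1 (max b k') := by simpa using hr 1
  have hz0 : z.1 0 = x'.1 0 := by rw [← P'.toBase_apply _ (max b k'), hz, P'.toBase_apply]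
  have hlift : IsLift (f γ) (p'.trans r) := by
    obtain ⟨c, hc⟩ := exists_const_path hz0
    refine ⟨c, hc, ?_⟩
    have := const_comp_cl_of_apply_eq (p := projPath 0 r) (q := s₀) (fun t => by
      rw [hs₀, ← hr, P'.toBase_apply]; rfl) (s := Path.refl _) (fun _ => rfl) hc
    rw [cl_refl, Category.id_comp] at this
    rw [e, projPath_trans, cl_trans, Category.assoc, this]
  obtain ⟨v, τ, hτ⟩ := exists_image_path φ (x' := w) (by
    have := hp' 1
    rw [p'.target, p.target] at this
    rw [this, hφψ]) r
  obtain ⟨t, t₀, ht, ht₀, e'⟩ := hk' (f γ) hmem z _ hlift v (p.trans τ) (fun u => by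
    rw [Path.trans_apply, Path.trans_apply]
    split_ifs
    · rw [hp', hφψ]
    · rw [hτ])
  -- At level 0 the composed covering is the identity.
  obtain rfl : t₀ = t := Path.ext (funext ht₀)
  obtain ⟨c, hc, ec⟩ := hp
  rw [e', projPath_trans, cl_trans, Category.assoc, ec]
  congr 1
  have hτD : (projPath 0 τ).Small D := fun u u' => by
    rw [projPath_apply, projPath_apply, hτ, hτ]
    refine hVD (r u) (r u') ?_
    rw [hr, hr]
    exact hs u u'
  have := hnull (((projPath 0 τ).trans t₀).trans (Path.refl _)) c
    (htrans _ _ _ hτD ht (Small.of_const hD fun _ => rfl)) (Small.of_const hD₀ hc)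
  rw [cl_trans, cl_trans, cl_refl, Category.comp_id] at this
  exact this

end SolenoidPresentation

/-! ### Steinitz numbers and indices in cyclic groups -/

namespace SteinitzNumber

/-- The exponents differ by finite amounts, and only at primes dividing `k`, so the quotient is a
positive integer. Truncated subtraction gives 0 where both exponents are infinite, which is the
right choice there. -/
theorem asympEquiv_of_le {ξ ξ' : SteinitzNumber} {k : ℕ}
    (h : ∀ p, ξ'.χ p ≤ ξ.χ p) (h' : ∀ p, ξ.χ p ≤ (ofNat k * ξ').χ p) : AsympEquiv ξ ξ' := by
  have hsub : ∀ p, ξ.χ p - ξ'.χ p ≤ (k.factorization p : ℕ∞) := fun p =>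
    tsub_le_iff_right.2 (h' p)
  let f : ℕ →₀ ℕ := Finsupp.onFinset k.primeFactors
    (fun p => if hp : p.Prime then (ξ.χ ⟨p, hp⟩ - ξ'.χ ⟨p, hp⟩).toNat else 0) (by
      intro p hp
      by_cases hpp : p.Prime
      · rw [← Nat.support_factorization, Finsupp.mem_support_iff]
        intro h0
        have := hsub ⟨p, hpp⟩
        simp only [h0, Nat.cast_zero, nonpos_iff_eq_zero] at this
        simp [hpp, this] at hp
      · simp [hpp] at hp)
  have hf : ∀ p ∈ f.support, p.Prime := fun p hp =>
    Nat.prime_of_mem_primeFactors (Finsupp.support_onFinset_subset hp)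
  refine ⟨1, f.prod (· ^ ·), le_rfl, ?_, ?_⟩
  · exact Finset.prod_pos fun p hp => Nat.pow_pos (hf p hp).pos
  · ext p
    change (((1 : ℕ).factorization p : ℕ) : ℕ∞) + ξ.χ p
      = (((f.prod (· ^ ·)).factorization p : ℕ) : ℕ∞) + ξ'.χ p
    rw [Nat.prod_pow_factorization_eq_self hf]
    have hfp : f p = (ξ.χ p - ξ'.χ p).toNat := by
      change (if hp : (p : ℕ).Prime then (ξ.χ ⟨p, hp⟩ - ξ'.χ ⟨p, hp⟩).toNat else 0) = _
      exact dif_pos p.2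
    rw [hfp, ENat.natCast_toNat (ne_top_of_le_ne_top (ENat.natCast_ne_top _) (hsub p)),
      tsub_add_cancel_of_le (h p)]
    simp

end SteinitzNumber

theorem Subgroup.relIndex_zpowers_eq {Γ : Type*} [Group Γ] (C : Subgroup Γ) (γ : Γ) :
    C.relIndex (Subgroup.zpowers γ) = (C.comap (zpowersHom Γ γ)).index := by
  rw [Subgroup.index_comap]
  rfl

/-- Both indices are indices in `ℤ` of sets of exponents, which makes elements of different groups
comparable. -/
theorem Subgroup.relIndex_zpowers_dvd {Γ Γ' : Type*} [Group Γ] [Group Γ'] {C : Subgroup Γ}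
    {C' : Subgroup Γ'} {γ : Γ} {γ' : Γ'} (h : ∀ n : ℤ, γ' ^ n ∈ C' → γ ^ n ∈ C) :
    C.relIndex (Subgroup.zpowers γ) ∣ C'.relIndex (Subgroup.zpowers γ') := by
  rw [relIndex_zpowers_eq, relIndex_zpowers_eq]
  exact Subgroup.index_dvd_of_le fun n hn => h n.toAdd hn

theorem Subgroup.relIndex_zpowers_dvd_mul {Γ : Type*} [Group Γ] (C : Subgroup Γ) (γ : Γ) (k : ℕ) :
    C.relIndex (Subgroup.zpowers γ) ∣
      (Subgroup.zpowers (γ ^ k)).relIndex (Subgroup.zpowers γ) *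
        C.relIndex (Subgroup.zpowers (γ ^ k)) := by
  have hle : Subgroup.zpowers (γ ^ k) ≤ Subgroup.zpowers γ :=
    Subgroup.zpowers_le.2 (Subgroup.npow_mem_zpowers γ k)
  have h := Subgroup.relIndex_mul_relIndex (C ⊓ Subgroup.zpowers (γ ^ k))
    (Subgroup.zpowers (γ ^ k)) (Subgroup.zpowers γ) inf_le_right hle
  rw [Subgroup.inf_relIndex_right] at h
  rw [mul_comm, h]
  exact Subgroup.relIndex_dvd_of_le_left _ inf_le_left

theorem Subgroup.relIndex_zpowers_pow_ne_zero {Γ : Type*} [Group Γ] (γ : Γ) {k : ℕ} (hk : k ≠ 0) :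
    (Subgroup.zpowers (γ ^ k)).relIndex (Subgroup.zpowers γ) ≠ 0 := by
  rw [relIndex_zpowers_eq]
  have hle : Subgroup.zpowers (Multiplicative.ofAdd (k : ℤ)) ≤
      (Subgroup.zpowers (γ ^ k)).comap (zpowersHom Γ γ) := by
    rw [Subgroup.zpowers_le, Subgroup.mem_comap]
    simp
  have h1 : (Subgroup.zpowers (Multiplicative.ofAdd (k : ℤ))).index = k := by
    have := Int.index_zmultiples (k : ℤ)
    rwa [Int.natAbs_natCast] at this
  intro h0
  have := Subgroup.index_dvd_of_le hle
  rw [h0, h1, zero_dvd_iff] at this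
  exact hk this

/-! ### Restricted orders and commensurability of group chains -/

namespace GroupChain

variable {Γ Γ' Γ'' : Type*} [Group Γ] [Group Γ'] [Group Γ'']

theorem mem_restrictedCore {G : GroupChain Γ} {H : Subgroup Γ} {ℓ : ℕ} {g : Γ} :
    g ∈ G.restrictedCore H ℓ ↔ ∀ δ ∈ H, δ⁻¹ * g * δ ∈ G.sub ℓ := by
  simp only [restrictedCore, Subgroup.mem_iInf, Subgroup.mem_map, MulEquiv.coe_toMonoidHom,
    MulAut.conj_apply]
  refine forall₂_congr fun δ _ => ⟨?_, fun h => ⟨_, h, by group⟩⟩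
  rintro ⟨y, hy, rfl⟩
  simpa [mul_assoc] using hy

theorem restrictedCore_antitone (G : GroupChain Γ) (H : Subgroup Γ) :
    Antitone (G.restrictedCore H) := fun _ _ h _ hg =>
  mem_restrictedCore.2 fun δ hδ => G.antitone h (mem_restrictedCore.1 hg δ hδ)

theorem finiteIndex_restrictedCore (G : GroupChain Γ) (H : Subgroup Γ) (ℓ : ℕ) :
    (G.restrictedCore H ℓ).FiniteIndex := by
  have := G.finiteIndex ℓ
  refine Subgroup.finiteIndex_of_le (H := (G.sub ℓ).normalCore) fun g hg => ?_
  refine mem_restrictedCore.2 fun δ _ => ?_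
  simpa using hg δ⁻¹

theorem relIndex_restrictedCore_ne_zero (G : GroupChain Γ) (H : Subgroup Γ) (ℓ : ℕ)
    (K : Subgroup Γ) : (G.restrictedCore H ℓ).relIndex K ≠ 0 :=
  have := G.finiteIndex_restrictedCore H ℓ
  Subgroup.FiniteIndex.index_ne_zero (H := (G.restrictedCore H ℓ).subgroupOf K)

theorem restrictedOrder_le {G : GroupChain Γ} {G' : GroupChain Γ'} {H : Subgroup Γ}
    {H' : Subgroup Γ'} {γ : Γ} {γ' : Γ'}
    (h : ∀ ℓ, ∃ m, ∀ n : ℤ, γ' ^ n ∈ G'.restrictedCore H' m → γ ^ n ∈ G.restrictedCore H ℓ)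
    (p : Nat.Primes) : (G.restrictedOrder H γ).χ p ≤ (G'.restrictedOrder H' γ').χ p := by
  refine iSup_le fun ℓ => ?_
  obtain ⟨m, hm⟩ := h ℓ.1
  -- The lcm runs over positive levels only, hence `m + 1`.
  refine le_trans ?_ (le_iSup (fun m : {m : ℕ // 0 < m} => ((SteinitzNumber.ofNat
      (Nat.card (Subgroup.zpowers γ' ⧸
        (G'.restrictedCore H' m.1).subgroupOf (Subgroup.zpowers γ')))).χ p)) ⟨m + 1, m.succ_pos⟩)
  have hdvd := Subgroup.relIndex_zpowers_dvd (C := G.restrictedCore H ℓ.1)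
    (C' := G'.restrictedCore H' (m + 1)) (γ := γ) (γ' := γ')
    fun n hn => hm n (G'.restrictedCore_antitone H' m.le_succ hn)
  exact Nat.cast_le.2 ((Nat.factorization_le_iff_dvd (G.relIndex_restrictedCore_ne_zero H _ _)
    (G'.relIndex_restrictedCore_ne_zero H' _ _)).2 hdvd p)

theorem restrictedOrder_eq {G : GroupChain Γ} {G' : GroupChain Γ'} {H : Subgroup Γ}
    {H' : Subgroup Γ'} {γ : Γ} {γ' : Γ'}
    (h : ∀ ℓ, ∃ m, ∀ n : ℤ, γ' ^ n ∈ G'.restrictedCore H' m → γ ^ n ∈ G.restrictedCore H ℓ)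
    (h' : ∀ m, ∃ ℓ, ∀ n : ℤ, γ ^ n ∈ G.restrictedCore H ℓ → γ' ^ n ∈ G'.restrictedCore H' m) :
    G.restrictedOrder H γ = G'.restrictedOrder H' γ' :=
  SteinitzNumber.ext (funext fun p => le_antisymm (restrictedOrder_le h p) (restrictedOrder_le h' p))

/-- The order of `γ ^ k` divides that of `γ`, which divides it times the finite index of `⟨γ ^ k⟩`
in `⟨γ⟩`. -/
theorem type_restrictedOrder_pow (G : GroupChain Γ) (H : Subgroup Γ) (γ : Γ) {k : ℕ}
    (hk : k ≠ 0) : (G.restrictedOrder H (γ ^ k)).type = (G.restrictedOrder H γ).type := by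
  refine (Quotient.sound (SteinitzNumber.asympEquiv_of_le
    (k := (Subgroup.zpowers (γ ^ k)).relIndex (Subgroup.zpowers γ)) ?_ fun p => ?_)).symm
  · refine restrictedOrder_le fun ℓ => ⟨ℓ, fun n hn => ?_⟩
    rw [← zpow_natCast, ← zpow_mul, mul_comm, zpow_mul]
    exact_mod_cast pow_mem hn k
  · refine iSup_le fun ℓ => ?_
    refine le_trans ?_ (add_le_add_right (le_iSup (fun m : {m : ℕ // 0 < m} =>
      ((SteinitzNumber.ofNat (Nat.card (Subgroup.zpowers (γ ^ k) ⧸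
        (G.restrictedCore H m.1).subgroupOf (Subgroup.zpowers (γ ^ k))))).χ p)) ℓ) _)
    have h0 := G.relIndex_restrictedCore_ne_zero H ℓ.1 (Subgroup.zpowers (γ ^ k))
    have h1 := Subgroup.relIndex_zpowers_pow_ne_zero γ hk
    have hdvd := Subgroup.relIndex_zpowers_dvd_mul (G.restrictedCore H ℓ.1) γ k
    have := (Nat.factorization_le_iff_dvd (G.relIndex_restrictedCore_ne_zero H ℓ.1 _)
      (mul_ne_zero h1 h0)).2 hdvd p
    rw [Nat.factorization_mul h1 h0, Finsupp.add_apply] at this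
    refine (Nat.cast_le.2 this).trans (Nat.cast_add _ _).le

/-- The restricted typeset only depends on the elements of a given finite index subgroup. -/
theorem mem_restrictedTypeset_iff (G : GroupChain Γ) (H K : Subgroup Γ) [K.FiniteIndex]
    {τ : SteinitzType} :
    τ ∈ G.restrictedTypeset H ↔ ∃ γ ∈ K, τ = (G.restrictedOrder H γ).type := by
  refine ⟨?_, fun ⟨γ, _, h⟩ => ⟨γ, h⟩⟩
  rintro ⟨γ, rfl⟩
  obtain ⟨k, hk, -, hγ⟩ := Subgroup.exists_pow_mem_of_index_ne_zero
    (H := K) Subgroup.FiniteIndex.index_ne_zero γ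
  exact ⟨γ ^ k, hγ, (G.type_restrictedOrder_pow H γ hk.ne').symm⟩

/-- Group chains with maps `f` and `g` between them that are continuous and mutually inverse on deep
terms, with `f` multiplicative on a deep term, have commensurable typesets. -/
theorem typesetsCommensurable_of_maps {G : GroupChain Γ} {G' : GroupChain Γ'} {f : Γ → Γ'}
    {g : Γ' → Γ} {a : ℕ} (hmul : ∀ γ₁ ∈ G.sub a, ∀ γ₂ ∈ G.sub a, f (γ₁ * γ₂) = f γ₁ * f γ₂)
    (hf : ∀ m, ∃ k, ∀ γ ∈ G.sub k, f γ ∈ G'.sub m)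
    (hg : ∀ m, ∃ k, ∀ γ ∈ G'.sub k, g γ ∈ G.sub m)
    (hgf : ∃ k, ∀ γ ∈ G.sub k, g (f γ) = γ) (hfg : ∃ k, ∀ γ ∈ G'.sub k, f (g γ) = γ) :
    G.TypesetsCommensurable G' := by
  obtain ⟨b, hb⟩ := hgf
  obtain ⟨c, hc⟩ := hfg
  -- Deep enough for `f` to be multiplicative and inverted by `g`, and of positive level as
  -- commensurability demands.
  let K := max a (max b 1)
  have hKa : G.sub K ≤ G.sub a := G.antitone (le_max_left _ _)
  have hKb : G.sub K ≤ G.sub b := G.antitone ((le_max_left _ _).trans (le_max_right _ _))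
  have hK1 : 1 ≤ K := (le_max_right _ _).trans (le_max_right _ _)
  let F : G.sub K →* Γ' := MonoidHom.mk' (fun γ => f γ) fun γ₁ γ₂ =>
    hmul _ (hKa γ₁.2) _ (hKa γ₂.2)
  obtain ⟨d, hd⟩ := hg K
  -- Past level `d`, `g` lands in the domain of `F`; past level `c`, it gives preimages under `f`.
  have hrange : G'.sub (max (max c d) 1) ≤ F.range := fun y hy => by
    have hyc := G'.antitone ((le_max_left c d).trans (le_max_left _ 1)) hy
    have hyd := G'.antitone ((le_max_right c d).trans (le_max_left _ 1)) hy
    exact ⟨⟨g y, hd y hyd⟩, hc y hyc⟩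
  have hfin := G.finiteIndex K
  have hfin' : F.range.FiniteIndex := by
    have := G'.finiteIndex (max (max c d) 1)
    exact Subgroup.finiteIndex_of_le hrange
  have horder : ∀ γ : G.sub K,
      G.restrictedOrder (G.sub K) (γ : Γ) = G'.restrictedOrder F.range (F γ) := by
    intro γ
    have hconj : ∀ (δ : G.sub K) (n : ℤ), (F δ)⁻¹ * F γ ^ n * F δ
        = f ((δ : Γ)⁻¹ * (γ : Γ) ^ n * δ) := fun δ n => by
      rw [← map_zpow, ← map_inv, ← map_mul, ← map_mul]
      rfl
    refine restrictedOrder_eq (fun ℓ => ?_) fun m => ?_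
    · obtain ⟨m, hm⟩ := hg ℓ
      refine ⟨m, fun n hn => mem_restrictedCore.2 fun δ hδ => ?_⟩
      have h1 := mem_restrictedCore.1 hn (F ⟨δ, hδ⟩) ⟨_, rfl⟩
      rw [hconj] at h1
      have h2 := hm _ h1
      rwa [hb] at h2
      exact hKb (mul_mem (mul_mem (inv_mem hδ) (zpow_mem γ.2 n)) hδ)
    · obtain ⟨ℓ, hℓ⟩ := hf m
      refine ⟨ℓ, fun n hn => mem_restrictedCore.2 ?_⟩
      rintro _ ⟨δ, rfl⟩
      rw [hconj]
      exact hℓ _ (mem_restrictedCore.1 hn δ δ.2)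
  refine ⟨G.sub K, F.range, hfin, ⟨K, hK1, le_rfl⟩, hfin', ⟨_, le_max_right _ _, hrange⟩, ?_⟩
  ext τ
  rw [G.mem_restrictedTypeset_iff _ (G.sub K), G'.mem_restrictedTypeset_iff _ F.range]
  constructor
  · rintro ⟨γ, hγ, rfl⟩
    exact ⟨F ⟨γ, hγ⟩, ⟨_, rfl⟩, congrArg _ (horder ⟨γ, hγ⟩)⟩
  · rintro ⟨_, ⟨γ, rfl⟩, rfl⟩
    exact ⟨γ, γ.2, (congrArg _ (horder γ)).symm⟩

/-- Commensurability is not affected by replacing the second group chain by one whose deep terms are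
conjugate to those of the given chain, by elements of a deep term. -/
theorem TypesetsCommensurable.of_conj {G : GroupChain Γ} {G' : GroupChain Γ'}
    {G'' : GroupChain Γ''} (h : G.TypesetsCommensurable G')
    (hconj : ∀ k, ∃ θ : Γ' ≃* Γ'', ∀ ℓ ≥ k, ∃ g ∈ G'.sub k,
      ∀ y, θ y ∈ G''.sub ℓ ↔ g⁻¹ * y * g ∈ G'.sub ℓ) :
    G.TypesetsCommensurable G'' := by
  obtain ⟨H, H', hH, hℓ, hH', ⟨k, hk, hkH⟩, e⟩ := h
  obtain ⟨θ, hθ⟩ := hconj k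
  have hle : G''.sub k ≤ H'.map θ.toMonoidHom := fun z hz => by
    obtain ⟨y, rfl⟩ := θ.surjective z
    obtain ⟨g, hg, hgy⟩ := hθ k le_rfl
    have h1 := mul_mem (mul_mem hg ((hgy y).1 hz)) (inv_mem hg)
    have h2 : g * (g⁻¹ * y * g) * g⁻¹ = y := by group
    rw [h2] at h1
    exact ⟨y, hkH h1, rfl⟩
  have hcore : ∀ ℓ ≥ k, ∀ y,
      θ y ∈ G''.restrictedCore (H'.map θ.toMonoidHom) ℓ ↔ y ∈ G'.restrictedCore H' ℓ := by
    intro ℓ hℓ y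
    obtain ⟨g, hg, hgy⟩ := hθ ℓ hℓ
    rw [mem_restrictedCore, mem_restrictedCore]
    constructor
    · intro h δ hδ
      -- The conjugator lies in `H'`, so multiplying by it merely reindexes the intersection over
      -- `H'`.
      have := h (θ (δ * g⁻¹)) ⟨_, mul_mem hδ (inv_mem (hkH hg)), rfl⟩
      rw [← map_inv, ← map_mul, ← map_mul, hgy] at this
      simpa [mul_assoc] using this
    · rintro h _ ⟨δ, hδ, rfl⟩
      have := h (δ * g) (mul_mem hδ (hkH hg))
      change (θ δ)⁻¹ * θ y * θ δ ∈ _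
      rw [← map_inv, ← map_mul, ← map_mul, hgy]
      simpa [mul_assoc] using this
  have horder : ∀ y, G'.restrictedOrder H' y
      = G''.restrictedOrder (H'.map θ.toMonoidHom) (θ y) := fun y =>
    restrictedOrder_eq
      (fun ℓ => ⟨max ℓ k, fun n hn => G'.restrictedCore_antitone H' (le_max_left ℓ k) (by
        rwa [← map_zpow, hcore _ (le_max_right _ _)] at hn)⟩)
      (fun ℓ => ⟨max ℓ k, fun n hn => G''.restrictedCore_antitone _ (le_max_left ℓ k) (by
        rwa [← map_zpow, hcore _ (le_max_right _ _)])⟩)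
  refine ⟨H, H'.map θ.toMonoidHom, hH, hℓ, ?_, ⟨k, hk, hle⟩, ?_⟩
  · have := G''.finiteIndex k
    exact Subgroup.finiteIndex_of_le hle
  · rw [e]
    ext τ
    constructor
    · rintro ⟨y, rfl⟩
      exact ⟨θ y, congrArg _ (horder y)⟩
    · rintro ⟨z, rfl⟩
      obtain ⟨y, rfl⟩ := θ.surjective z
      exact ⟨y, congrArg _ (horder y).symm⟩

end GroupChain

/-! ### Change of basepoint -/

namespace SolenoidPresentation

open Path

variable {n : ℕ} {P : SolenoidPresentation.{u} n}

/-- The projection to `M_0` of a path in `M_ℓ` between points of two threads. -/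
def basePath {y z : P.Solenoid} (ℓ : ℕ) (v : Path (y.1 ℓ) (z.1 ℓ)) : Path (y.1 0) (z.1 0) :=
  (v.map (P.toBase ℓ).continuous).cast (P.toBase_apply y ℓ).symm (P.toBase_apply z ℓ).symm

theorem basePath_trans {x y z : P.Solenoid} (ℓ : ℕ) (v : Path (x.1 ℓ) (y.1 ℓ))
    (w : Path (y.1 ℓ) (z.1 ℓ)) :
    basePath ℓ (v.trans w) = (basePath ℓ v).trans (basePath ℓ w) := by
  ext t
  simp only [basePath, Path.cast_coe, Path.map_coe, Function.comp_apply, Path.trans_apply]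
  split_ifs <;> rfl

theorem mem_chainSubgroup_iff {x : P.Solenoid} {ℓ : ℕ} {γ : FundamentalGroup (P.M 0) (x.1 0)} :
    γ ∈ P.chainSubgroup x ℓ ↔ ∃ δ : Path (x.1 ℓ) (x.1 ℓ), (basePath ℓ δ).cl = γ := by
  constructor
  · rintro ⟨δ, rfl⟩
    induction δ using Path.Homotopic.Quotient.ind with
    | mk δ => exact ⟨δ, (FundamentalGroup.mapOfEq_apply (P.toBase ℓ) (P.toBase_apply x ℓ) δ.cl).symm⟩
  · rintro ⟨δ, rfl⟩
    exact ⟨δ.cl, FundamentalGroup.mapOfEq_apply _ _ _⟩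

theorem conj_mem_chainSubgroup {x y : P.Solenoid} {ℓ : ℕ} (v : Path (x.1 ℓ) (y.1 ℓ))
    {γ : FundamentalGroup (P.M 0) (x.1 0)} (hγ : γ ∈ P.chainSubgroup x ℓ) :
    ((basePath ℓ v).symm.cl ≫ γ ≫ (basePath ℓ v).cl : FundamentalGroup (P.M 0) (y.1 0)) ∈
      P.chainSubgroup y ℓ := by
  obtain ⟨δ, rfl⟩ := mem_chainSubgroup_iff.1 hγ
  refine mem_chainSubgroup_iff.2 ⟨v.symm.trans (δ.trans v), ?_⟩
  rw [basePath_trans, basePath_trans, cl_trans, cl_trans]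
  rfl

theorem conj_inv_eq {N : Type*} [TopologicalSpace N] {a b : N} (p q : Path a b)
    (γ g : FundamentalGroup N a) (hg : g = q.cl ≫ p.symm.cl) :
    g⁻¹ * γ * g = q.cl ≫ (p.symm.cl ≫ γ ≫ p.cl) ≫ q.symm.cl := by
  subst hg
  let g' : FundamentalGroup N a := p.cl ≫ q.symm.cl
  have hinv : (show FundamentalGroup N a from q.cl ≫ p.symm.cl)⁻¹ = g' := by
    rw [inv_eq_iff_mul_eq_one]
    change (p.cl ≫ q.symm.cl) ≫ (q.cl ≫ p.symm.cl) = 𝟙 _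
    rw [Category.assoc, ← Category.assoc q.symm.cl, cl_symm_trans, Category.id_comp,
      cl_trans_symm]
  rw [hinv]
  change (q.cl ≫ p.symm.cl) ≫ (γ ≫ (p.cl ≫ q.symm.cl)) = _
  simp only [Category.assoc]

theorem level_eq_of_le {y z : P.Solenoid} {k ℓ : ℕ} (h : k ≤ ℓ) (e : y.1 ℓ = z.1 ℓ) :
    y.1 k = z.1 k := by
  induction ℓ, h using Nat.le_induction with
  | base => exact e
  | succ m _ ih => exact ih (by rw [← y.2 m, ← z.2 m, e])

instance (ℓ : ℕ) : PathConnectedSpace (P.M ℓ) :=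
  pathConnectedSpace_iff_connectedSpace.2 inferInstance

/-- The group chains at two basepoints are, beyond any given level `k`, conjugate by elements of the
`k`-th term. -/
theorem exists_basepoint_change (x y : P.Solenoid) (k : ℕ) :
    ∃ θ : FundamentalGroup (P.M 0) (x.1 0) ≃* FundamentalGroup (P.M 0) (y.1 0),
      ∀ ℓ ≥ k, ∃ g ∈ P.chainSubgroup x k, ∀ γ,
        θ γ ∈ P.chainSubgroup y ℓ ↔ g⁻¹ * γ * g ∈ P.chainSubgroup x ℓ := by
  let c := PathConnectedSpace.somePath (x.1 k) (y.1 k)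
  refine ⟨FundamentalGroup.fundamentalGroupMulEquivOfPath (basePath k c), fun ℓ hℓ => ?_⟩
  let v := PathConnectedSpace.somePath (x.1 ℓ) (y.1 ℓ)
  have hθ : ∀ γ, FundamentalGroup.fundamentalGroupMulEquivOfPath (basePath k c) γ =
    (basePath k c).symm.cl ≫ γ ≫ (basePath k c).cl := fun γ => rfl
  refine ⟨(basePath ℓ v).cl ≫ (basePath k c).symm.cl, ?_, fun γ => ?_⟩
  -- Seen at level `k`, the path `v` followed by the reverse of `c` is already a loop, so the
  -- conjugator belongs to the `k`-th term.
  · obtain ⟨w, p, hp⟩ := exists_lift_path x v rfl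
    have hw : w.1 ℓ = y.1 ℓ := by simpa using hp 1
    have hwk := level_eq_of_le hℓ hw
    have hw0 := level_eq_of_le (Nat.zero_le ℓ) hw
    have h := mem_chainSubgroup p (c.symm.cast hwk rfl) ((basePath k c).symm.cast hw0 rfl)
      fun t => rfl
    have hp0 : projPath 0 p = (basePath ℓ v).cast rfl hw0 := by
      ext t
      change (p t).1 0 = P.toBase ℓ (v t)
      rw [← hp, P.toBase_apply]
    have hcast : ∀ {a b c b' : P.M 0} (p : Path a b) (q : Path b c) (e : b' = b),
        (p.cast rfl e).cl ≫ (q.cast e rfl).cl = p.cl ≫ q.cl := by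
      rintro a b c b' p q rfl
      rfl
    rwa [hp0, hcast] at h
  · have hg := conj_inv_eq (basePath k c) (basePath ℓ v) γ _ rfl
    rw [hg, hθ]
    constructor
    · intro h
      have h' := conj_mem_chainSubgroup v.symm h
      have e : basePath ℓ v.symm = (basePath ℓ v).symm := rfl
      rwa [e, Path.symm_symm] at h'
    · intro h
      have h' := conj_mem_chainSubgroup v h
      have e : (basePath ℓ v).symm.cl ≫ ((basePath ℓ v).cl ≫
          ((basePath k c).symm.cl ≫ γ ≫ (basePath k c).cl) ≫ (basePath ℓ v).symm.cl) ≫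
          (basePath ℓ v).cl = (basePath k c).symm.cl ≫ γ ≫ (basePath k c).cl := by
        rw [Category.assoc, ← Category.assoc, cl_symm_trans, Category.id_comp, Category.assoc,
          cl_symm_trans, Category.comp_id]
      rwa [e] at h'

end SolenoidPresentation

end

theorem theorem7p6 {n n' : ℕ} (P : SolenoidPresentation.{u} n) (P' : SolenoidPresentation.{v} n')
    (h : Nonempty (P.Solenoid ≃ₜ P'.Solenoid)) (x : P.Solenoid) (x' : P'.Solenoid) :
    (P.groupChain x).TypesetsCommensurable (P'.groupChain x') := by
  obtain ⟨φ⟩ := h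
  let ψ : C(P.Solenoid, P'.Solenoid) := ⟨φ, φ.continuous⟩
  let ψ' : C(P'.Solenoid, P.Solenoid) := ⟨φ.symm, φ.symm.continuous⟩
  have hψ'ψ : ∀ y, ψ' (ψ y) = y := φ.symm_apply_apply
  have hψψ' : ∀ y, ψ (ψ' y) = y := φ.apply_symm_apply
  have hx : ψ' (φ x) = x := hψ'ψ x
  obtain ⟨a, f, hmul, hf⟩ := SolenoidPresentation.exists_induced_map ψ x (φ x) rfl
  -- Multiplicativity of `g` is not needed: `f` alone supplies the homomorphism.
  obtain ⟨-, g, -, hg⟩ := SolenoidPresentation.exists_induced_map ψ' (φ x) x hx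
  have hcomm : (P.groupChain x).TypesetsCommensurable (P'.groupChain (φ x)) :=
    GroupChain.typesetsCommensurable_of_maps hmul (hf.exists_mem rfl) (hg.exists_mem hx)
      (hf.exists_leftInverse hψ'ψ rfl hg) (hg.exists_leftInverse hψψ' hx hf)
  exact hcomm.of_conj (SolenoidPresentation.exists_basepoint_change (φ x) x')
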